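/- Let $n\ge 1$, let $E=\{v\in\mathbb{R}^{n+1}\mid \sum_i v_i=0\}$ with the standard inner product $(\cdot,\cdot)$, and let $\Phi=\{\varepsilon_i-\varepsilon_j\mid i\ne j\}\subset E$ be the root system of type $A_n$, with positive roots $\Phi_+=\{\varepsilon_i-\varepsilon_j\mid i<j\}$, simple roots $\alpha_i=\varepsilon_i-\varepsilon_{i+1}$ $(1\le i\le n)$, highest root $\theta=\alpha_1+\dots+\alpha_n$, root lattice $\mathbb{Z}\Phi$, and fundamental weights $\varpi_1,\dots,\varpi_n$ (the basis dual to $\alpha_1,\dots,\alpha_n$). For $\alpha\in\Phi$ and $k\in\mathbb{Z}$ put $H_{\alpha,k}=\{v\in E\mid(\alpha,v)=k\}$ and let $s_{\alpha,k}$ be the orthogonal reflection through $H_{\alpha,k}$. Let $W$ be the affine Weyl group of type $\widetilde{A}_n$, i.e. the group generated by all $s_{\alpha,k}$, with fundamental alcove $A_+=\{v\in E\mid -1<(\alpha,v)<0\text{ for all }\alpha\in\Phi_+\}$ and simple reflections $s_{\alpha_1,0},\dots,s_{\alpha_n,0},s_{\theta,-1}$ (the reflections in the walls of $A_+$), and let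 $\le$ be the Bruhat order of this Coxeter system. For $z\in W$ let $A_z=zA_+$; for $\lambda\in\mathbb{Z}\Phi$ let $z+\lambda$ be the element of $W$ with $A_{z+\lambda}=A_z+\lambda$. Let $C_+=\{v\in E\mid(\alpha,v)>0\text{ for all }\alpha\in\Phi_+\}$ and let $W_+=\{z\in W\mid A_z\subset C_+\}$ be the set of dominant elements. Let $x,y\in W_+$ with $x\le y$, let $[x,y]=\{z\in W\mid x\le z\le y\}$, and define $$I(x,y)=\{1\le i\le n\mid \overline{A_z}\cap H_{\alpha_i,0}\ne\emptyset\text{ for some }z\in[x,y]\cap W_+\}.$$ Then for every $\lambda\in\mathbb{Z}\Phi\cap\bigoplus_{i\notin I(x,y)}\mathbb{Z}_{\ge0}\,\varpi_i$ the map $$[x,y]\cap W_+\to[x+\lambda,y+\lambda]\cap W_+,\qquad z\mapsto z+\lambda,$$ is well defined and is an isomorphism of posets (for the Bruhat order). -/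

import Mathlib

/-! The affine Weyl group of type `Ãₙ`, realised as a group of transformations of a Euclidean
space, with its alcoves and its Bruhat order. -/

namespace AffineTypeA

/-- The vectors of `ℝ^(n+1)` with coordinate sum zero. -/
def sumZero (n : ℕ) : Submodule ℝ (EuclideanSpace ℝ (Fin (n + 1))) where
  carrier := {v | ∑ i, v i = 0}
  add_mem' {u v} hu hv := by
    change ∑ i, (u i + v i) = 0
    rw [Finset.sum_add_distrib, show ∑ i, u i = 0 from hu, show ∑ i, v i = 0 from hv, add_zero]
  zero_mem' := by
    change ∑ i : Fin (n + 1), (0 : ℝ) = 0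
    exact Finset.sum_const_zero
  smul_mem' r v hv := by
    change ∑ i, r * v i = 0
    rw [← Finset.mul_sum, show ∑ i, v i = 0 from hv, mul_zero]

/-- The Euclidean space `E` of dimension `n`: the vectors of `ℝ^(n+1)` with coordinate sum zero,
with the inner product inherited from `ℝ^(n+1)`. -/
def E (n : ℕ) : Type := ↥(sumZero n)

noncomputable instance (n : ℕ) : NormedAddCommGroup (E n) :=
  inferInstanceAs (NormedAddCommGroup ↥(sumZero n))

noncomputable instance (n : ℕ) : InnerProductSpace ℝ (E n) :=
  inferInstanceAs (InnerProductSpace ℝ ↥(sumZero n))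

/-- A vector of `ℝ^(n+1)` with coordinate sum zero, as an element of `E n`. -/
noncomputable def mkE {n : ℕ} (f : Fin (n + 1) → ℝ) (hf : ∑ i, f i = 0) : E n :=
  ⟨WithLp.toLp 2 f, hf⟩

/-- The vector `ε_i - ε_j`. -/
noncomputable def root {n : ℕ} (i j : Fin (n + 1)) : E n :=
  mkE (fun k => (if k = i then 1 else 0) - (if k = j then 1 else 0)) (by simp)

/-- The root system `Φ` of type `Aₙ`. -/
def roots (n : ℕ) : Set (E n) := {a | ∃ i j : Fin (n + 1), i ≠ j ∧ a = root i j}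

/-- The positive roots `ε_i - ε_j` with `i < j`. -/
def posRoots (n : ℕ) : Set (E n) := {a | ∃ i j : Fin (n + 1), i < j ∧ a = root i j}

/-- The simple roots `α_1, …, α_n`; they are indexed by `Fin n`, that is, from `0`. -/
noncomputable def simpleRoot {n : ℕ} (i : Fin n) : E n := root i.castSucc i.succ

/-- The highest root `α_1 + ⋯ + α_n`. -/
noncomputable def highestRoot (n : ℕ) : E n := root 0 (Fin.last n)

/-- The root lattice `ℤΦ`. -/
noncomputable def rootLattice (n : ℕ) : AddSubgroup (E n) := AddSubgroup.closure (roots n)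

/-- The fundamental weights: `ϖ_m` is `(1, …, 1, 0, …, 0)` with `m` ones, projected to `E`. In the
indexing of the simple roots by `Fin n` the number of ones is `i + 1`. -/
noncomputable def fundWeight {n : ℕ} (i : Fin n) : E n :=
  mkE (fun k => (if k ≤ i.castSucc then 1 else 0) - ((i : ℝ) + 1) / ((n : ℝ) + 1)) (by
    have h : (Finset.univ.filter fun k : Fin (n + 1) => k ≤ i.castSucc).card = (i : ℕ) + 1 := by
      have h' : (Finset.univ.filter fun k : Fin (n + 1) => k ≤ i.castSucc) =
          Finset.Iic i.castSucc := by ext; simp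
      rw [h', Fin.card_Iic, Fin.val_castSucc]
    have hn : ((n : ℝ) + 1) ≠ 0 := by positivity
    rw [Finset.sum_sub_distrib, Finset.sum_boole, h]
    simp only [Finset.sum_const, Finset.card_univ, Fintype.card_fin, nsmul_eq_mul]
    push_cast
    field_simp
    ring)

theorem inner_eq_sum {n : ℕ} (u v : E n) : inner ℝ u v = ∑ i, u.1 i * v.1 i := by
  have h : inner ℝ u v = inner ℝ (u.1 : EuclideanSpace ℝ (Fin (n + 1))) v.1 := rfl
  simp [h, PiLp.inner_apply, mul_comm]

theorem inner_mkE {n : ℕ} (f : Fin (n + 1) → ℝ) (hf : ∑ i, f i = 0) (i j : Fin (n + 1)) :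
    inner ℝ (mkE f hf) (root i j) = f i - f j := by
  rw [inner_eq_sum]
  simp [root, mkE, mul_sub, Finset.sum_sub_distrib]

/-- The fundamental weights are the basis dual to the simple roots. -/
theorem inner_fundWeight_simpleRoot {n : ℕ} (i j : Fin n) :
    inner ℝ (fundWeight i) (simpleRoot j) = if i = j then (1 : ℝ) else 0 := by
  unfold fundWeight simpleRoot
  rw [inner_mkE]
  simp only [Fin.le_def, Fin.val_castSucc, Fin.val_succ, Fin.ext_iff]
  split_ifs <;> first | omega | norm_num

/-- The hyperplane `H_{α,k}`. -/
def hyperplane {n : ℕ} (a : E n) (k : ℤ) : Set (E n) := {v | inner ℝ a v = (k : ℝ)}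

theorem reflection_involutive {n : ℕ} (a : E n) (k : ℤ) : Function.Involutive
    (fun v : E n => v - (2 * (inner ℝ a v - (k : ℝ)) / inner ℝ a a) • a) := by
  intro v
  by_cases ha : a = 0
  · simp [ha]
  have h : (inner ℝ a a : ℝ) ≠ 0 := by simpa using ha
  simp only [inner_sub_right, real_inner_smul_right]
  rw [sub_sub, ← add_smul, sub_eq_self]
  convert zero_smul ℝ a using 2
  field_simp
  ring

/-- The orthogonal reflection `s_{α,k}` through `H_{α,k}`. -/
noncomputable def reflection {n : ℕ} (a : E n) (k : ℤ) : Equiv.Perm (E n) :=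
  (reflection_involutive a k).toPerm

/-- The affine Weyl group `W` of type `Ãₙ`: the group of transformations of `E` generated by all
the reflections `s_{α,k}` with `α ∈ Φ` and `k ∈ ℤ`. -/
def affineWeyl (n : ℕ) : Subgroup (Equiv.Perm (E n)) :=
  Subgroup.closure {g | ∃ a ∈ roots n, ∃ k : ℤ, g = reflection a k}

/-- The affine Weyl group as a type. -/
abbrev W (n : ℕ) : Type := ↥(affineWeyl n)

/-- The fundamental alcove; in the convention used here it lies in the antidominant chamber, and
its vertices are `0, -ϖ_1, …, -ϖ_n`. -/
def fundAlcove (n : ℕ) : Set (E n) :=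
  {v | ∀ a ∈ posRoots n, -1 < (inner ℝ a v : ℝ) ∧ (inner ℝ a v : ℝ) < 0}

/-- The simple reflections `s_1, …, s_n` and `s_0`, through the walls `H_{α_i,0}` and `H_{θ,-1}`
of the fundamental alcove (`θ` is the highest root). -/
def simpleReflections (n : ℕ) : Set (W n) :=
  {s | (∃ i : Fin n, (s : Equiv.Perm (E n)) = reflection (simpleRoot i) 0) ∨
    (s : Equiv.Perm (E n)) = reflection (highestRoot n) (-1)}

/-- The Coxeter length: the least length of a word in the simple reflections. -/
noncomputable def length {n : ℕ} (w : W n) : ℕ :=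
  sInf {k | ∃ l : List (W n), l.length = k ∧ (∀ s ∈ l, s ∈ simpleReflections n) ∧ l.prod = w}

/-- The reflections of the Coxeter group: the conjugates of the simple reflections. -/
def IsReflection {n : ℕ} (t : W n) : Prop :=
  ∃ w : W n, ∃ s ∈ simpleReflections n, t = w * s * w⁻¹

/-- One step up in the Bruhat order: `v = u t` for a reflection `t`, with `ℓ(u) < ℓ(v)`. -/
def BruhatStep {n : ℕ} (u v : W n) : Prop :=
  ∃ t : W n, IsReflection t ∧ v = u * t ∧ length u < length v

theorem eq_or_length_lt {n : ℕ} {u v : W n} (h : Relation.ReflTransGen BruhatStep u v) :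
    u = v ∨ length u < length v := by
  induction h with
  | refl => exact Or.inl rfl
  | tail _ h₂ ih =>
    obtain ⟨t, _, _, hlt⟩ := h₂
    rcases ih with ih | ih
    · exact Or.inr (ih ▸ hlt)
    · exact Or.inr (ih.trans hlt)

/-- The Bruhat order on `W`. -/
instance bruhatOrder (n : ℕ) : PartialOrder (W n) where
  le := Relation.ReflTransGen BruhatStep
  le_refl _ := Relation.ReflTransGen.refl
  le_trans _ _ _ h₁ h₂ := Relation.ReflTransGen.trans h₁ h₂
  le_antisymm _ _ h₁ h₂ := by
    rcases eq_or_length_lt h₁ with h | h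
    · exact h
    rcases eq_or_length_lt h₂ with h' | h'
    · exact h'.symm
    exact absurd (h.trans h') (lt_irrefl _)

/-- The alcove `A_z`, the image of the fundamental alcove under `z`. -/
def alcove {n : ℕ} (z : W n) : Set (E n) := (z : Equiv.Perm (E n)) '' fundAlcove n

/-- The (open) dominant chamber `C₊`. -/
def dominantChamber (n : ℕ) : Set (E n) := {v | ∀ a ∈ posRoots n, 0 < (inner ℝ a v : ℝ)}

/-- The set `W₊` of dominant elements. -/
def dominantElements (n : ℕ) : Set (W n) := {z | alcove z ⊆ dominantChamber n}

/-- The set `I(x,y)` of the indices `i` such that the closed alcove of some dominant element of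
`[x,y]` meets the wall `H_{α_i,0}`. -/
def touchedWalls {n : ℕ} (x y : W n) : Set (Fin n) :=
  {i | ∃ z ∈ Set.Icc x y ∩ dominantElements n,
    (closure (alcove z) ∩ hyperplane (simpleRoot i) 0).Nonempty}

/-- Translations by elements of the root lattice belong to `W`. -/
theorem addLeft_mem_affineWeyl {n : ℕ} {m : E n} (hm : m ∈ rootLattice n) :
    Equiv.addLeft m ∈ affineWeyl n := by
  unfold rootLattice at hm
  induction hm using AddSubgroup.closure_induction with
  | mem a ha =>
    have h : Equiv.addLeft a = reflection a 1 * reflection a 0 := by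
      ext1 v
      by_cases h0 : a = 0
      · simp [reflection, h0]
      have h : (inner ℝ a a : ℝ) ≠ 0 := by simpa using h0
      have h2 : (inner ℝ a a : ℝ) = 2 := by
        obtain ⟨i, j, hij, rfl⟩ := ha
        conv_lhs => arg 2; unfold root
        rw [inner_mkE]
        simp only [if_true, hij, hij.symm, if_false]
        norm_num
      simp only [reflection, Function.Involutive.coe_toPerm, Equiv.Perm.mul_apply,
        Equiv.coe_addLeft, inner_sub_right, real_inner_smul_right, h2, Int.cast_zero, Int.cast_one]
      rw [sub_sub, ← add_smul, add_comm, sub_eq_add_neg, ← neg_smul]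
      congr 1
      conv_lhs => rw [← one_smul ℝ a]
      congr 1
      ring
    rw [h]
    exact mul_mem (Subgroup.subset_closure ⟨a, ha, 1, rfl⟩)
      (Subgroup.subset_closure ⟨a, ha, 0, rfl⟩)
  | zero => simp [one_mem]
  | add a b _ _ iha ihb =>
    have h : Equiv.addLeft (a + b) = Equiv.addLeft a * Equiv.addLeft b := by
      ext1 v
      simp
    rw [h]
    exact mul_mem iha ihb
  | neg a _ iha =>
    have h : Equiv.addLeft (-a) = (Equiv.addLeft a)⁻¹ := by
      rw [eq_inv_iff_mul_eq_one]
      ext1 v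
      simp
    rw [h]
    exact inv_mem iha

/-- The element `z + m` of `W`, for `m` in the root lattice: its alcove is the translate of the
alcove of `z` by `m` (see `alcove_translate`). -/
noncomputable def translate {n : ℕ} (m : rootLattice n) (z : W n) : W n :=
  ⟨Equiv.addLeft (m : E n) * (z : Equiv.Perm (E n)),
    mul_mem (addLeft_mem_affineWeyl m.2) z.2⟩

theorem alcove_translate {n : ℕ} (m : rootLattice n) (z : W n) :
    alcove (translate m z) = (fun v => (m : E n) + v) '' alcove z := by
  unfold alcove
  rw [Set.image_image]
  rfl

end AffineTypeA

namespace AffineTypeA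

/-! ### Coordinates -/

/-! Each alcove is represented by the image of the barycentre of `A₊`, which lies on no hyperplane.
So the Coxeter combinatorics of `W` becomes inequalities between the real numbers `diff z a b` and
integers. A gallery argument yields the exchange condition, a geometric form of Bruhat steps
(`bruhatStep_iff`) and the lifting property.

Translation by `m` is left multiplication by an element `T`. Since `m` is dominant, the hyperplanes
separating `T⁻¹` from `1` have negative level on positive roots, so none of them separates `1` from
a dominant alcove. Hence a reduced word of `T` can be cancelled letter by letter in Bruhat
inequalities between dominant elements (`translate_le_translate_iff`). This gives an order
embedding.

Surjectivity is where the touched walls enter. A dominant `w` below `T y` is reached from `T y`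
through dominant covers (`exists_dominant_coatom`). Each cover reflects in the nearest lower
parallel hyperplane (`exists_refl_of_dominant_cover`). Such a reflection lowers the pairing with
`α_i` by less than 1, unless its root is `α_i` itself; then the pairing stays above the next lower
integer level. If `y` has pairing at least 1 with every `α_i` that `m` moves, the lower element is
therefore again the translate of a dominant element (`dominant_of_translate_cover`), and induction
applies to a smaller interval. The pairing is at least 1 off the touched walls because an alcove in
the first strip along a wall has a vertex on that wall (`closure_alcove_inter_wall_nonempty`). -/

theorem coord_ext {n : ℕ} {u v : E n} (h : ∀ i, u.1 i = v.1 i) : u = v :=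
  Subtype.ext (PiLp.ext h)

theorem root_coord {n : ℕ} (a b i : Fin (n + 1)) :
    (root a b : E n).1 i = (if i = a then 1 else 0) - (if i = b then 1 else 0) := rfl

theorem inner_root {n : ℕ} (a b : Fin (n + 1)) (v : E n) :
    inner ℝ (root a b) v = v.1 a - v.1 b := by
  rw [real_inner_comm]
  exact inner_mkE (fun i => v.1 i) v.2 a b

theorem inner_root_self {n : ℕ} {a b : Fin (n + 1)} (h : a ≠ b) :
    inner ℝ (root a b : E n) (root a b) = (2 : ℝ) := by
  rw [inner_root, root_coord, root_coord]
  simp [h, h.symm]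
  norm_num

theorem reflection_coord {n : ℕ} {a b : Fin (n + 1)} (h : a ≠ b) (k : ℤ) (v : E n)
    (i : Fin (n + 1)) : (reflection (root a b) k v).1 i =
      v.1 (Equiv.swap a b i) + (if i = a then k else if i = b then -k else 0 : ℤ) := by
  have key : (reflection (root a b) k v).1 i = v.1 i -
      (2 * (inner ℝ (root a b) v - (k : ℝ)) / inner ℝ (root a b : E n) (root a b)) *
        (root a b : E n).1 i := rfl
  rw [key, inner_root_self h, inner_root, root_coord]
  by_cases ha : i = a
  · subst ha
    simp [h]
    ring
  by_cases hb : i = b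
  · subst hb
    simp [h.symm]
    ring
  rw [Equiv.swap_apply_of_ne_of_ne ha hb]
  simp [ha, hb]

/-- The reflection in the hyperplane `v_a - v_b = k`, as an element of `W`. -/
noncomputable def refl {n : ℕ} (a b : Fin (n + 1)) (h : a ≠ b) (k : ℤ) : W n :=
  ⟨reflection (root a b) k, Subgroup.subset_closure ⟨_, ⟨a, b, h, rfl⟩, k, rfl⟩⟩

theorem refl_coord {n : ℕ} {a b : Fin (n + 1)} (h : a ≠ b) (k : ℤ) (v : E n)
    (i : Fin (n + 1)) : ((refl a b h k : W n).1 v).1 i =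
      v.1 (Equiv.swap a b i) + (if i = a then k else if i = b then -k else 0 : ℤ) :=
  reflection_coord h k v i

theorem refl_coord_left {n : ℕ} {a b : Fin (n + 1)} (h : a ≠ b) (k : ℤ) (v : E n) :
    ((refl a b h k : W n).1 v).1 a = v.1 b + k := by
  simp [refl_coord]

theorem refl_coord_right {n : ℕ} {a b : Fin (n + 1)} (h : a ≠ b) (k : ℤ) (v : E n) :
    ((refl a b h k : W n).1 v).1 b = v.1 a - k := by
  simp [refl_coord, h.symm, sub_eq_add_neg]

theorem refl_coord_of_ne {n : ℕ} {a b : Fin (n + 1)} (h : a ≠ b) (k : ℤ) (v : E n)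
    {i : Fin (n + 1)} (ha : i ≠ a) (hb : i ≠ b) : ((refl a b h k : W n).1 v).1 i = v.1 i := by
  simp [refl_coord, ha, hb, Equiv.swap_apply_of_ne_of_ne ha hb]

theorem W_ext {n : ℕ} {u v : W n} (h : ∀ p i, (u.1 p).1 i = (v.1 p).1 i) : u = v :=
  Subtype.ext (Equiv.ext fun p => coord_ext (h p))

theorem mul_apply_coord {n : ℕ} (u v : W n) (p : E n) : (u * v).1 p = u.1 (v.1 p) := rfl

theorem refl_symm {n : ℕ} {a b : Fin (n + 1)} (h : a ≠ b) (k : ℤ) :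
    (refl a b h k : W n) = refl b a h.symm (-k) := by
  refine W_ext fun p i => ?_
  by_cases ha : i = a
  · subst ha
    rw [refl_coord_left, refl_coord_right]
    simp
  by_cases hb : i = b
  · subst hb
    rw [refl_coord_left, refl_coord_right]
    simp [sub_eq_add_neg]
  rw [refl_coord_of_ne h k p ha hb, refl_coord_of_ne _ _ p hb ha]

theorem refl_mul_self {n : ℕ} {a b : Fin (n + 1)} (h : a ≠ b) (k : ℤ) :
    (refl a b h k : W n) * refl a b h k = 1 :=
  Subtype.ext (Equiv.ext fun v => reflection_involutive (root a b) k v)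

/-- Serves twice: to generate all levels from the levels 0 and -1, and to factor a reflection that
skips a hyperplane into three steps. -/
theorem refl_mul_refl_mul {n : ℕ} {a b : Fin (n + 1)} (h : a ≠ b) (j k l : ℤ) :
    (refl a b h j : W n) * (refl a b h k * refl a b h l) = refl a b h (j - k + l) := by
  refine W_ext fun p i => ?_
  by_cases ha : i = a
  · subst ha
    simp only [mul_apply_coord, refl_coord_left, refl_coord_right]
    push_cast
    ring
  by_cases hb : i = b
  · subst hb
    simp only [mul_apply_coord, refl_coord_left, refl_coord_right]
    push_cast
    ring
  simp only [mul_apply_coord, refl_coord_of_ne h _ _ ha hb]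

/-- Elements of `W` permute the coordinates and shift them by integers. -/
theorem exists_perm_shift {n : ℕ} (z : W n) : ∃ (σ : Equiv.Perm (Fin (n + 1)))
    (c : Fin (n + 1) → ℤ), ∀ v i, (z.1 v).1 i = v.1 (σ i) + c i := by
  obtain ⟨z, hz⟩ := z
  change ∃ (σ : Equiv.Perm (Fin (n + 1))) (c : Fin (n + 1) → ℤ),
    ∀ v i, (z v).1 i = v.1 (σ i) + c i
  unfold affineWeyl at hz
  induction hz using Subgroup.closure_induction with
  | mem r hr =>
    obtain ⟨_, ⟨a, b, h, rfl⟩, k, rfl⟩ := hr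
    exact ⟨Equiv.swap a b, _, reflection_coord h k⟩
  | one => exact ⟨1, 0, by simp⟩
  | mul u v _ _ hu hv =>
    obtain ⟨σ, c, hc⟩ := hu
    obtain ⟨τ, e, he⟩ := hv
    refine ⟨τ * σ, fun i => e (σ i) + c i, fun p i => ?_⟩
    rw [Equiv.Perm.mul_apply, hc, he]
    simp [add_assoc]
  | inv u _ hu =>
    obtain ⟨σ, c, hc⟩ := hu
    refine ⟨σ⁻¹, fun i => - c (σ⁻¹ i), fun p i => ?_⟩
    have := hc (u⁻¹ p) (σ⁻¹ i)
    rw [show u (u⁻¹ p) = p from u.apply_symm_apply p,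
      show σ (σ⁻¹ i) = i from σ.apply_symm_apply i] at this
    rw [this]
    simp

/-- `W` permutes the hyperplanes, compatibly with the reflections in them. -/
theorem exists_pullback {n : ℕ} (z : W n) {a b : Fin (n + 1)} (h : a ≠ b) (k : ℤ) :
    ∃ (a' b' : Fin (n + 1)) (h' : a' ≠ b') (k' : ℤ),
      (∀ v, (z.1 v).1 a - (z.1 v).1 b - k = v.1 a' - v.1 b' - k') ∧
      refl a b h k * z = z * refl a' b' h' k' := by
  obtain ⟨σ, c, hc⟩ := exists_perm_shift z
  refine ⟨σ a, σ b, σ.injective.ne h, k - c a + c b, fun v => ?_, W_ext fun p i => ?_⟩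
  · rw [hc, hc]
    push_cast
    ring
  · by_cases ha : i = a
    · subst ha
      simp only [mul_apply_coord, refl_coord_left, hc]
      push_cast
      ring
    by_cases hb : i = b
    · subst hb
      simp only [mul_apply_coord, refl_coord_right, hc]
      push_cast
      ring
    simp only [mul_apply_coord, refl_coord_of_ne h _ _ ha hb, hc]
    rw [refl_coord_of_ne _ _ _ (σ.injective.ne ha) (σ.injective.ne hb)]

/-! ### A base point of the fundamental alcove -/

/-- The barycentre of the fundamental alcove. -/
noncomputable def basePoint (n : ℕ) : E n :=
  mkE (fun i => ((i : ℝ) - n / 2) / (n + 1)) (by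
    rw [← Finset.sum_div, Finset.sum_sub_distrib, Fin.sum_univ_eq_sum_range (fun i => (i : ℝ)),
      ← Nat.cast_sum]
    have h : ((∑ i ∈ Finset.range (n + 1), i : ℕ) : ℝ) * 2 = (n + 1) * n := by
      have := Finset.sum_range_id_mul_two (n + 1)
      rw [Nat.add_sub_cancel] at this
      exact_mod_cast this
    have h2 : ((∑ i ∈ Finset.range (n + 1), i : ℕ) : ℝ) = (n + 1) * n / 2 := by linarith
    rw [h2]
    simp
    left
    ring)

theorem basePoint_coord {n : ℕ} (i : Fin (n + 1)) :
    (basePoint n).1 i = ((i : ℝ) - n / 2) / (n + 1) := rfl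

theorem basePoint_sub {n : ℕ} (a b : Fin (n + 1)) :
    (basePoint n).1 a - (basePoint n).1 b = ((a : ℝ) - b) / (n + 1) := by
  rw [basePoint_coord, basePoint_coord]
  ring

/-- The difference of the coordinates `a` and `b` at the base point of the alcove of `z`. -/
noncomputable def diff {n : ℕ} (z : W n) (a b : Fin (n + 1)) : ℝ :=
  (z.1 (basePoint n)).1 a - (z.1 (basePoint n)).1 b

theorem diff_one {n : ℕ} (a b : Fin (n + 1)) : diff (1 : W n) a b = ((a : ℝ) - b) / (n + 1) :=
  basePoint_sub a b

theorem diff_one_neg {n : ℕ} {a b : Fin (n + 1)} (h : a < b) : diff (1 : W n) a b < 0 := by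
  rw [diff_one]
  have h' : (a : ℝ) < b := by exact_mod_cast h
  exact div_neg_of_neg_of_pos (by linarith) (by positivity)

theorem neg_one_lt_diff_one {n : ℕ} (a b : Fin (n + 1)) : -1 < diff (1 : W n) a b := by
  rw [diff_one, lt_div_iff₀ (by positivity)]
  have h1 : (b : ℝ) < n + 1 := by exact_mod_cast b.2
  have h2 : (0 : ℝ) ≤ a := by positivity
  linarith

theorem diff_one_lt_one {n : ℕ} (a b : Fin (n + 1)) : diff (1 : W n) a b < 1 := by
  rw [diff_one, div_lt_iff₀ (by positivity)]
  have h1 : (a : ℝ) < n + 1 := by exact_mod_cast a.2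
  have h2 : (0 : ℝ) ≤ b := by positivity
  linarith

theorem diff_symm {n : ℕ} (z : W n) (a b : Fin (n + 1)) : diff z b a = - diff z a b := by
  unfold diff
  ring

theorem diff_one_ne {n : ℕ} {a b : Fin (n + 1)} (h : a ≠ b) (k : ℤ) :
    diff (1 : W n) a b ≠ k := by
  intro hk
  have h1 := neg_one_lt_diff_one (n := n) a b
  have h2 := diff_one_lt_one (n := n) a b
  rw [hk] at h1 h2
  have h3 : -1 < k := by exact_mod_cast h1
  have h4 : k < 1 := by exact_mod_cast h2
  obtain rfl : k = 0 := by omega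
  rcases lt_or_gt_of_ne h with h | h
  · exact (diff_one_neg h).ne (by simpa using hk)
  · have := diff_one_neg h
    rw [diff_symm, hk] at this
    simp at this

theorem exists_pullback_diff {n : ℕ} (z : W n) {a b : Fin (n + 1)} (h : a ≠ b) (k : ℤ) :
    ∃ (a' b' : Fin (n + 1)) (h' : a' ≠ b') (k' : ℤ),
      (∀ u, diff (z * u) a b - k = diff u a' b' - k') ∧
      refl a b h k * z = z * refl a' b' h' k' := by
  obtain ⟨a', b', h', k', h1, h2⟩ := exists_pullback z h k
  exact ⟨a', b', h', k', fun u => h1 _, h2⟩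

theorem diff_ne {n : ℕ} (z : W n) {a b : Fin (n + 1)} (h : a ≠ b) (k : ℤ) : diff z a b ≠ k := by
  obtain ⟨a', b', h', k', h1, -⟩ := exists_pullback_diff z h k
  have := h1 1
  rw [mul_one] at this
  intro hk
  exact diff_one_ne h' k' (by linarith)

theorem diff_refl_mul {n : ℕ} (z : W n) {a b : Fin (n + 1)} (h : a ≠ b) (k : ℤ) :
    diff (refl a b h k * z) a b = 2 * k - diff z a b := by
  unfold diff
  rw [mul_apply_coord, refl_coord_left, refl_coord_right]
  ring

/-- The alcoves of `u` and `v` lie on the same side of the hyperplane `v_a - v_b = k`. -/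
def SameSide {n : ℕ} (a b : Fin (n + 1)) (k : ℤ) (u v : W n) : Prop :=
  diff u a b < k ↔ diff v a b < k

theorem SameSide.symm {n : ℕ} {a b : Fin (n + 1)} {k : ℤ} {u v : W n}
    (h : SameSide a b k u v) : SameSide a b k v u := Iff.symm h

theorem SameSide.trans {n : ℕ} {a b : Fin (n + 1)} {k : ℤ} {u v w : W n}
    (h : SameSide a b k u v) (h' : SameSide a b k v w) : SameSide a b k u w := Iff.trans h h'

theorem SameSide.trans_not {n : ℕ} {a b : Fin (n + 1)} {k : ℤ} {u v w : W n}
    (h : ¬ SameSide a b k u v) (h' : ¬ SameSide a b k v w) : SameSide a b k u w := by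
  unfold SameSide at *
  tauto

theorem not_sameSide_refl_mul {n : ℕ} (z : W n) {a b : Fin (n + 1)} (h : a ≠ b) (k : ℤ) :
    ¬ SameSide a b k z (refl a b h k * z) := by
  unfold SameSide
  rw [diff_refl_mul]
  have := diff_ne z h k
  rcases lt_or_gt_of_ne this with h1 | h1
  · intro h2
    linarith [h2.1 h1]
  · intro h2
    linarith [h2.2 (by linarith)]

theorem sameSide_pullback {n : ℕ} (z : W n) {a b : Fin (n + 1)} (h : a ≠ b) (k : ℤ) :
    ∃ (a' b' : Fin (n + 1)) (h' : a' ≠ b') (k' : ℤ),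
      (∀ u v, SameSide a b k (z * u) (z * v) ↔ SameSide a' b' k' u v) ∧
      refl a b h k * z = z * refl a' b' h' k' := by
  obtain ⟨a', b', h', k', h1, h2⟩ := exists_pullback_diff z h k
  refine ⟨a', b', h', k', fun u v => ?_, h2⟩
  unfold SameSide
  rw [← sub_neg, h1, sub_neg, ← sub_neg (b := (k : ℝ)), h1, sub_neg]

/-! ### Simple reflections -/

theorem mem_simpleReflections {n : ℕ} (hn : 1 ≤ n) {s : W n} (hs : s ∈ simpleReflections n) :
    (∃ i : Fin n, s = refl i.castSucc i.succ (Fin.castSucc_lt_succ).ne 0) ∨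
      s = refl 0 (Fin.last n) (by simp [Fin.ext_iff]; omega) (-1) := by
  rcases hs with ⟨i, hi⟩ | h
  · exact Or.inl ⟨i, Subtype.ext hi⟩
  · exact Or.inr (Subtype.ext h)

theorem refl_mem_simpleReflections {n : ℕ} (i : Fin n) :
    refl i.castSucc i.succ (Fin.castSucc_lt_succ).ne 0 ∈ simpleReflections n :=
  Or.inl ⟨i, rfl⟩

theorem simple_mul_self {n : ℕ} (hn : 1 ≤ n) {s : W n} (hs : s ∈ simpleReflections n) :
    s * s = 1 := by
  rcases mem_simpleReflections hn hs with ⟨i, rfl⟩ | rfl <;> exact refl_mul_self _ _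

/-- For every pair `a < b` other than the one defining `s`, the difference at the reflected
barycentre stays in `(-1, 0)`, which contains no integer. -/
theorem eq_of_not_sameSide_of_lt {n : ℕ} (hn : 1 ≤ n) {s : W n} (hs : s ∈ simpleReflections n)
    {a b : Fin (n + 1)} (h : a < b) {k : ℤ} (hk : ¬ SameSide a b k 1 s) :
    s = refl a b h.ne k := by
  have hN : (0 : ℝ) < n + 1 := by positivity
  have h1 := neg_one_lt_diff_one (n := n) a b
  have h2 := diff_one_neg (n := n) h
  have key : ∀ x : ℝ, -1 < x → x < 0 → diff s a b = x → False := by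
    intro x hx hx0 hsx
    apply hk
    unfold SameSide
    rw [hsx]
    constructor <;> intro h3
    · have : -1 < k := by exact_mod_cast h1.trans h3
      have : (0 : ℝ) ≤ k := by exact_mod_cast (by omega : 0 ≤ k)
      linarith
    · have : -1 < k := by exact_mod_cast hx.trans h3
      have : (0 : ℝ) ≤ k := by exact_mod_cast (by omega : 0 ≤ k)
      linarith
  have key2 : ∀ x y : Fin (n + 1), x < y → diff s a b = diff 1 x y → False := fun x y hxy hd =>
    key _ (neg_one_lt_diff_one x y) (diff_one_neg hxy) hd
  rcases mem_simpleReflections hn hs with ⟨i, rfl⟩ | rfl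
  · have hs : diff (refl i.castSucc i.succ (Fin.castSucc_lt_succ).ne 0) a b =
        diff 1 (Equiv.swap i.castSucc i.succ a) (Equiv.swap i.castSucc i.succ b) := by
      unfold diff
      rw [refl_coord, refl_coord]
      simp
    by_cases hab : a = i.castSucc ∧ b = i.succ
    · obtain ⟨rfl, rfl⟩ := hab
      congr 1
      rw [Equiv.swap_apply_left, Equiv.swap_apply_right, diff_symm _ i.castSucc] at hs
      unfold SameSide at hk
      rw [hs] at hk
      by_contra hk0
      apply hk
      rcases lt_or_gt_of_ne hk0 with h3 | h3
      · have : (1 : ℝ) ≤ k := by exact_mod_cast h3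
        constructor <;> intro <;> linarith
      · have : (k : ℝ) ≤ -1 := by exact_mod_cast (by omega : k ≤ -1)
        constructor <;> intro <;> linarith
    -- An adjacent transposition preserves the order of every other pair `a < b`.
    · refine (key2 _ _ ?_ hs).elim
      rw [Equiv.swap_apply_def, Equiv.swap_apply_def]
      simp only [Fin.ext_iff, Fin.lt_def, Fin.val_castSucc, Fin.val_succ] at hab h ⊢
      split_ifs <;> (try simp only [Fin.val_castSucc, Fin.val_succ]) <;> omega
  · have h0l : (0 : Fin (n + 1)) ≠ Fin.last n := by simp [Fin.ext_iff]; omega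
    by_cases hab : a = 0 ∧ b = Fin.last n
    · obtain ⟨rfl, rfl⟩ := hab
      congr 1
      have hs : diff (refl 0 (Fin.last n) h0l (-1)) 0 (Fin.last n) = - 2 - diff 1 0 (Fin.last n) := by
        have := diff_refl_mul (1 : W n) h0l (-1)
        rw [mul_one] at this
        rw [this]
        push_cast
        ring
      unfold SameSide at hk
      rw [hs] at hk
      by_contra hk0
      apply hk
      rcases lt_or_gt_of_ne hk0 with h3 | h3
      · have : (0 : ℝ) ≤ k := by exact_mod_cast (by omega : 0 ≤ k)
        constructor <;> intro <;> linarith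
      · have : (k : ℝ) ≤ -2 := by exact_mod_cast (by omega : k ≤ -2)
        constructor <;> intro <;> linarith
    · exfalso
      have hA : a = 0 ∨ ((a : ℝ) ≥ 1 ∧ a ≠ 0) := by
        rcases eq_or_ne a 0 with h | h
        · exact Or.inl h
        · refine Or.inr ⟨?_, h⟩
          have : 1 ≤ (a : ℕ) := Nat.one_le_iff_ne_zero.2 (fun h' => h (Fin.ext h'))
          exact_mod_cast this
      have hB : b = Fin.last n ∨ ((b : ℝ) + 1 ≤ n ∧ b ≠ Fin.last n) := by
        rcases eq_or_ne b (Fin.last n) with h | h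
        · exact Or.inl h
        · refine Or.inr ⟨?_, h⟩
          have : (b : ℕ) + 1 ≤ n := Fin.val_lt_last h
          exact_mod_cast this
      have hbl : b ≠ 0 := fun h' => by simp [h'] at h
      have hal : a ≠ Fin.last n := fun h' => by
        rw [h'] at h
        exact absurd h (not_lt.2 (Fin.le_last b))
      have hb0 : (0 : ℝ) ≤ b := by positivity
      rcases hA with rfl | ⟨ha1, ha⟩ <;> rcases hB with rfl | ⟨hb1, hb⟩
      · exact hab ⟨rfl, rfl⟩
      -- The barycentre has equally spaced coordinates, so the affine reflection just lowers the
      -- first one by `1/(n+1)` and raises the last one by `1/(n+1)`.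
      · refine key ((-1 - (b : ℝ)) / (n + 1)) ?_ ?_ ?_
        · rw [lt_div_iff₀ hN]
          linarith
        · exact div_neg_of_neg_of_pos (by linarith) hN
        · unfold diff
          rw [refl_coord_left, refl_coord_of_ne _ _ _ hbl hb, basePoint_coord, basePoint_coord]
          simp
          field_simp
          ring
      · refine key (((a : ℝ) - n - 1) / (n + 1)) ?_ ?_ ?_
        · rw [lt_div_iff₀ hN]
          linarith
        · have : (a : ℝ) < n := by exact_mod_cast Fin.val_lt_last hal
          exact div_neg_of_neg_of_pos (by linarith) hN
        · unfold diff
          rw [refl_coord_right, refl_coord_of_ne _ _ _ ha hal, basePoint_coord, basePoint_coord]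
          simp
          field_simp
          ring
      · refine key2 a b h ?_
        unfold diff
        rw [refl_coord_of_ne _ _ _ hbl hb, refl_coord_of_ne _ _ _ ha hal]
        rfl

theorem sameSide_symm_index {n : ℕ} {a b : Fin (n + 1)} (h : a ≠ b) (k : ℤ) (u v : W n) :
    SameSide b a (-k) u v ↔ SameSide a b k u v := by
  unfold SameSide
  rw [diff_symm u, diff_symm v]
  push_cast
  rw [neg_lt_neg_iff, neg_lt_neg_iff]
  rw [← (diff_ne u h k).le_iff_lt, ← (diff_ne v h k).le_iff_lt]
  simp only [← not_lt]
  tauto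

theorem eq_of_not_sameSide {n : ℕ} (hn : 1 ≤ n) {s : W n} (hs : s ∈ simpleReflections n)
    {a b : Fin (n + 1)} (h : a ≠ b) {k : ℤ} (hk : ¬ SameSide a b k 1 s) :
    s = refl a b h k := by
  rcases lt_or_gt_of_ne h with h' | h'
  · exact eq_of_not_sameSide_of_lt hn hs h' hk
  · rw [refl_symm]
    refine eq_of_not_sameSide_of_lt hn hs h' ?_
    rwa [sameSide_symm_index h]

/-- Adjacent alcoves are separated by one hyperplane only. -/
theorem refl_mul_eq_of_not_sameSide {n : ℕ} (hn : 1 ≤ n) {s : W n} (hs : s ∈ simpleReflections n)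
    {a b : Fin (n + 1)} (h : a ≠ b) {k : ℤ} {g : W n} (hk : ¬ SameSide a b k g (g * s)) :
    refl a b h k * g = g * s := by
  obtain ⟨a', b', h', k', h1, h2⟩ := sameSide_pullback g h k
  rw [h2, ← eq_of_not_sameSide hn hs h']
  rwa [← h1, mul_one]

/-! ### The simple reflections generate -/

theorem refl_zero_coord {n : ℕ} {a b : Fin (n + 1)} (h : a ≠ b) (v : E n) (i : Fin (n + 1)) :
    ((refl a b h 0 : W n).1 v).1 i = v.1 (Equiv.swap a b i) := by
  simp [refl_coord]

/-- Every permutation of the coordinates is a product of simple reflections. -/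
theorem exists_perm_mem_closure {n : ℕ} (σ : Equiv.Perm (Fin (n + 1))) :
    ∃ z ∈ Subgroup.closure (simpleReflections n), ∀ v i, (z.1 v).1 i = v.1 (σ i) := by
  have hσ : σ ∈ Submonoid.closure
      (Set.range fun i : Fin n => Equiv.swap i.castSucc i.succ) := by
    rw [Equiv.Perm.mclosure_swap_castSucc_succ]
    trivial
  induction hσ using Submonoid.closure_induction with
  | mem r hr =>
    obtain ⟨i, rfl⟩ := hr
    exact ⟨_, Subgroup.subset_closure (refl_mem_simpleReflections i), refl_zero_coord _⟩
  | one => exact ⟨1, one_mem _, fun _ _ => rfl⟩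
  | mul σ τ _ _ h1 h2 =>
    obtain ⟨u, hu, h1⟩ := h1
    obtain ⟨v, hv, h2⟩ := h2
    refine ⟨v * u, mul_mem hv hu, fun p i => ?_⟩
    rw [mul_apply_coord, h2, h1, Equiv.Perm.mul_apply]

theorem exists_perm_apply_eq {α : Type*} [DecidableEq α] {a b c d : α} (h : a ≠ b) (h' : c ≠ d) :
    ∃ σ : Equiv.Perm α, σ a = c ∧ σ b = d := by
  refine ⟨Equiv.swap (Equiv.swap a c b) d * Equiv.swap a c, ?_, ?_⟩
  · rw [Equiv.Perm.mul_apply, Equiv.swap_apply_left, Equiv.swap_apply_of_ne_of_ne _ h']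
    intro hc
    exact h ((Equiv.swap a c).injective ((Equiv.swap_apply_left a c).trans hc))
  · rw [Equiv.Perm.mul_apply, Equiv.swap_apply_left]

/-- Conjugating by coordinate permutations moves the root and keeps the level. -/
theorem refl_mem_closure_of_refl_mem_closure {n : ℕ} {a b c d : Fin (n + 1)} (h : a ≠ b)
    (h' : c ≠ d) {l : ℤ} (hl : refl a b h l ∈ Subgroup.closure (simpleReflections n)) :
    refl c d h' l ∈ Subgroup.closure (simpleReflections n) := by
  obtain ⟨σ, hc, hd⟩ := exists_perm_apply_eq h' h
  obtain ⟨z, hz, hzσ⟩ := exists_perm_mem_closure σ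
  have : refl c d h' l = z * refl a b h l * z⁻¹ := by
    rw [eq_mul_inv_iff_mul_eq]
    refine W_ext fun p i => ?_
    rw [mul_apply_coord, mul_apply_coord, hzσ]
    by_cases hi : i = c
    · subst hi
      rw [refl_coord_left, hc, refl_coord_left, hzσ, hd]
    by_cases hi' : i = d
    · subst hi'
      rw [refl_coord_right, hd, refl_coord_right, hzσ, hc]
    rw [refl_coord_of_ne _ _ _ hi hi', refl_coord_of_ne, hzσ]
    · rw [← hc]
      exact σ.injective.ne hi
    · rw [← hd]
      exact σ.injective.ne hi'
  rw [this]
  exact mul_mem (mul_mem hz hl) (inv_mem hz)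

theorem refl_mem_closure {n : ℕ} {a b : Fin (n + 1)} (h : a ≠ b) (k : ℤ) :
    refl a b h k ∈ Subgroup.closure (simpleReflections n) := by
  have hn : 1 ≤ n := by
    by_contra hn
    obtain rfl : n = 0 := by omega
    exact h (Fin.ext (by omega))
  have h0l : (0 : Fin (n + 1)) ≠ Fin.last n := by simp [Fin.ext_iff]; omega
  have h0 : refl a b h 0 ∈ Subgroup.closure (simpleReflections n) :=
    refl_mem_closure_of_refl_mem_closure (Fin.castSucc_lt_succ).ne h
      (Subgroup.subset_closure (refl_mem_simpleReflections ⟨0, hn⟩))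
  have hm : refl a b h (-1) ∈ Subgroup.closure (simpleReflections n) :=
    refl_mem_closure_of_refl_mem_closure h0l h (Subgroup.subset_closure (Or.inr rfl))
  -- Mirroring levels in 0 and in -1 reaches every integer.
  have conj : ∀ j k : ℤ, refl a b h j ∈ Subgroup.closure (simpleReflections n) →
      refl a b h k ∈ Subgroup.closure (simpleReflections n) →
      refl a b h (2 * j - k) ∈ Subgroup.closure (simpleReflections n) := fun j k hj hk => by
    rw [show 2 * j - k = j - k + j by ring, ← refl_mul_refl_mul h]
    exact mul_mem hj (mul_mem hk hj)
  have hnat : ∀ m : ℕ, refl a b h (-(m : ℤ)) ∈ Subgroup.closure (simpleReflections n) := by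
    intro m
    induction m using Nat.strong_induction_on with
    | _ m ih =>
      rcases m with _ | _ | m
      · exact h0
      · exact hm
      · have := conj (-1) _ hm (conj 0 _ h0 (ih m (by omega)))
        convert this using 2
        push_cast
        ring
  rcases le_total k 0 with hk | hk
  · have := hnat k.natAbs
    rwa [show -(k.natAbs : ℤ) = k by omega] at this
  · have := conj 0 _ h0 (hnat k.natAbs)
    rwa [show 2 * 0 - -(k.natAbs : ℤ) = k by omega] at this

theorem simpleReflections_closure {n : ℕ} (z : W n) :
    z ∈ Subgroup.closure (simpleReflections n) := by
  have h : affineWeyl n ≤ (Subgroup.closure (simpleReflections n)).map (affineWeyl n).subtype := by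
    conv_lhs => unfold affineWeyl
    rw [Subgroup.closure_le]
    rintro _ ⟨_, ⟨a, b, h, rfl⟩, k, rfl⟩
    exact ⟨_, refl_mem_closure h k, rfl⟩
  obtain ⟨w, hw, hwz⟩ := h z.2
  rwa [← Subtype.ext (a1 := w) (a2 := z) hwz]

/-! ### Words and the length -/

theorem exists_word {n : ℕ} (hn : 1 ≤ n) (z : W n) :
    ∃ l : List (W n), (∀ s ∈ l, s ∈ simpleReflections n) ∧ l.prod = z := by
  have h := simpleReflections_closure z
  rw [← Subgroup.mem_toSubmonoid, Subgroup.closure_toSubmonoid] at h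
  have hinv : (simpleReflections n)⁻¹ = simpleReflections n := by
    ext s
    rw [Set.mem_inv]
    constructor <;> intro hs
    · have := simple_mul_self hn hs
      rw [← inv_inv s, inv_eq_of_mul_eq_one_left this]
      exact hs
    · rwa [inv_eq_of_mul_eq_one_left (simple_mul_self hn hs)]
  rw [hinv, Set.union_self] at h
  obtain ⟨l, hl, hz⟩ := Submonoid.exists_list_of_mem_closure h
  exact ⟨l, hl, hz⟩

theorem exists_reduced_word {n : ℕ} (hn : 1 ≤ n) (z : W n) :
    ∃ l : List (W n), l.length = length z ∧ (∀ s ∈ l, s ∈ simpleReflections n) ∧ l.prod = z := by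
  obtain ⟨l, hl, hz⟩ := exists_word hn z
  exact Nat.sInf_mem (s := {k | ∃ l : List (W n), l.length = k ∧
    (∀ s ∈ l, s ∈ simpleReflections n) ∧ l.prod = z}) ⟨_, l, rfl, hl, hz⟩

theorem length_prod_le {n : ℕ} {l : List (W n)} (hl : ∀ s ∈ l, s ∈ simpleReflections n) :
    length l.prod ≤ l.length :=
  Nat.sInf_le ⟨l, rfl, hl, rfl⟩

theorem length_simple_mul_le {n : ℕ} (hn : 1 ≤ n) {s : W n} (hs : s ∈ simpleReflections n)
    (z : W n) : length (s * z) ≤ length z + 1 := by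
  obtain ⟨l, hlen, hl, rfl⟩ := exists_reduced_word hn z
  rw [← hlen, ← List.prod_cons, ← List.length_cons]
  exact length_prod_le (List.forall_mem_cons.2 ⟨hs, hl⟩)

theorem length_mul_simple_le {n : ℕ} (hn : 1 ≤ n) {s : W n} (hs : s ∈ simpleReflections n)
    (z : W n) : length (z * s) ≤ length z + 1 := by
  obtain ⟨l, hlen, hl, rfl⟩ := exists_reduced_word hn z
  have : l.prod * s = (l ++ [s]).prod := by simp
  rw [← hlen, this]
  refine (length_prod_le ?_).trans (by simp)
  intro t ht
  rcases List.mem_append.1 ht with ht | ht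
  · exact hl t ht
  · rw [List.mem_singleton.1 ht]
    exact hs

/-- A gallery between two alcoves on different sides of a hyperplane crosses it. -/
theorem exists_split_of_not_sameSide {n : ℕ} (hn : 1 ≤ n) {a b : Fin (n + 1)} (h : a ≠ b)
    {k : ℤ} (l : List (W n)) (hl : ∀ s ∈ l, s ∈ simpleReflections n) (g : W n)
    (hg : ¬ SameSide a b k g (g * l.prod)) : ∃ l₁ s l₂, l = l₁ ++ s :: l₂ ∧
      refl a b h k * (g * l₁.prod) = g * l₁.prod * s := by
  induction l generalizing g with
  | nil => exact absurd (Iff.refl _) (by rwa [List.prod_nil, mul_one] at hg)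
  | cons s l ih =>
    obtain ⟨hs, hl⟩ := List.forall_mem_cons.1 hl
    by_cases h1 : SameSide a b k g (g * s)
    · obtain ⟨l₁, t, l₂, rfl, ht⟩ := ih hl (g * s) (by
        intro h2
        rw [List.prod_cons, ← mul_assoc] at hg
        exact hg (h1.trans h2))
      refine ⟨s :: l₁, t, l₂, rfl, ?_⟩
      simpa [mul_assoc] using ht
    · exact ⟨[], s, l, rfl, by simpa using refl_mul_eq_of_not_sameSide hn hs h h1⟩

/-- Exchange condition: a reduced gallery to `z` crosses the hyperplane, and folding its tail back
there deletes one letter. -/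
theorem length_refl_mul_lt {n : ℕ} (hn : 1 ≤ n) {a b : Fin (n + 1)} (h : a ≠ b)
    {k : ℤ} {z : W n} (hz : ¬ SameSide a b k 1 z) : length (refl a b h k * z) < length z := by
  obtain ⟨l, hlen, hl, rfl⟩ := exists_reduced_word hn z
  obtain ⟨l₁, s, l₂, rfl, hs⟩ := exists_split_of_not_sameSide hn h l hl 1 (by rwa [one_mul])
  have hmem : s ∈ simpleReflections n := hl s (by simp)
  have : refl a b h k * (l₁ ++ s :: l₂).prod = (l₁ ++ l₂).prod := by
    rw [one_mul] at hs
    rw [List.prod_append, ← mul_assoc, hs, List.prod_cons, List.prod_append, mul_assoc,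
      ← mul_assoc s, simple_mul_self hn hmem, one_mul]
  rw [this, ← hlen]
  refine (length_prod_le fun t ht => hl t ?_).trans_lt (by simp)
  rcases List.mem_append.1 ht with ht | ht <;> simp [ht]

theorem length_refl_mul_lt_iff {n : ℕ} (hn : 1 ≤ n) {a b : Fin (n + 1)} (h : a ≠ b)
    {k : ℤ} {z : W n} : length (refl a b h k * z) < length z ↔ ¬ SameSide a b k 1 z := by
  refine ⟨fun hlt hz => ?_, length_refl_mul_lt hn h⟩
  have h1 : ¬ SameSide a b k 1 (refl a b h k * z) := fun h2 =>
    not_sameSide_refl_mul z h k (hz.symm.trans h2)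
  have := length_refl_mul_lt hn h h1
  rw [← mul_assoc, refl_mul_self, one_mul] at this
  omega

theorem lt_length_refl_mul_iff {n : ℕ} (hn : 1 ≤ n) {a b : Fin (n + 1)} (h : a ≠ b)
    {k : ℤ} {z : W n} : length z < length (refl a b h k * z) ↔ SameSide a b k 1 z := by
  have := length_refl_mul_lt_iff hn h (k := k) (z := refl a b h k * z)
  rw [← mul_assoc, refl_mul_self, one_mul] at this
  rw [this]
  have h3 := not_sameSide_refl_mul z h k
  exact ⟨fun h1 => SameSide.trans_not h1 (fun h2 => h3 h2.symm), fun h1 h2 => h3 (h1.symm.trans h2)⟩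

/-- The hyperplane separates `1` from its mirror image, so a gallery between them crosses it; the
crossing exhibits the conjugate. -/
theorem isReflection_refl {n : ℕ} (hn : 1 ≤ n) {a b : Fin (n + 1)} (h : a ≠ b) (k : ℤ) :
    IsReflection (refl a b h k) := by
  have hz := not_sameSide_refl_mul (1 : W n) h k
  rw [mul_one] at hz
  obtain ⟨l, hl, hlz⟩ := exists_word hn (refl a b h k)
  obtain ⟨l₁, s, l₂, rfl, hs⟩ := exists_split_of_not_sameSide hn h (k := k) l hl 1
    (by rwa [hlz, one_mul])
  exact ⟨l₁.prod, s, hl s (by simp), by rw [eq_mul_inv_iff_mul_eq]; simpa using hs⟩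

theorem IsReflection.conj {n : ℕ} {t : W n} (h : IsReflection t) (z : W n) :
    IsReflection (z * t * z⁻¹) := by
  obtain ⟨w, s, hs, rfl⟩ := h
  exact ⟨z * w, s, hs, by group⟩

theorem IsReflection.exists_refl {n : ℕ} (hn : 1 ≤ n) {t : W n} (h : IsReflection t) :
    ∃ (a b : Fin (n + 1)) (h : a ≠ b) (k : ℤ), t = refl a b h k := by
  obtain ⟨w, s, hs, rfl⟩ := h
  obtain ⟨a, b, h, k, rfl⟩ : ∃ (a b : Fin (n + 1)) (h : a ≠ b) (k : ℤ), s = refl a b h k := by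
    rcases mem_simpleReflections hn hs with ⟨i, rfl⟩ | rfl
    · exact ⟨_, _, _, _, rfl⟩
    · exact ⟨_, _, _, _, rfl⟩
  obtain ⟨a', b', h', k', -, h2⟩ := exists_pullback w⁻¹ h k
  refine ⟨a', b', h', k', ?_⟩
  rw [mul_assoc, h2, mul_inv_cancel_left]

/-- Conjugation by `u` turns the right factor `t` into a left one; a step is then a reflection away
from the fundamental alcove. -/
theorem bruhatStep_iff {n : ℕ} (hn : 1 ≤ n) {u v : W n} : BruhatStep u v ↔
    ∃ (a b : Fin (n + 1)) (h : a ≠ b) (k : ℤ), v = refl a b h k * u ∧ SameSide a b k 1 u := by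
  constructor
  · rintro ⟨t, ht, rfl, hlt⟩
    obtain ⟨a, b, h, k, hk⟩ := (ht.conj u).exists_refl hn
    have : u * t = refl a b h k * u := by rw [← hk]; group
    rw [this] at hlt
    exact ⟨a, b, h, k, this, (lt_length_refl_mul_iff hn h).1 hlt⟩
  · rintro ⟨a, b, h, k, rfl, hk⟩
    refine ⟨u⁻¹ * refl a b h k * u, ?_, by group, (lt_length_refl_mul_iff hn h).2 hk⟩
    simpa using (isReflection_refl hn h k).conj u⁻¹

theorem BruhatStep.le {n : ℕ} {u v : W n} (h : BruhatStep u v) : u ≤ v :=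
  Relation.ReflTransGen.single h

theorem BruhatStep.length_lt {n : ℕ} {u v : W n} (h : BruhatStep u v) : length u < length v := by
  obtain ⟨_, _, _, h⟩ := h
  exact h

theorem bruhatStep_of_length_eq {n : ℕ} {u v : W n} (h : u ≤ v)
    (hl : length v = length u + 1) : BruhatStep u v := by
  rcases Relation.ReflTransGen.cases_head h with rfl | ⟨w, hw, hwv⟩
  · omega
  · rcases eq_or_length_lt hwv with rfl | h'
    · exact hw
    · have := hw.length_lt
      omega

/-! ### The lifting property -/

theorem simple_isReflection {n : ℕ} {s : W n} (hs : s ∈ simpleReflections n) : IsReflection s :=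
  ⟨1, s, hs, by simp⟩

theorem le_simple_mul {n : ℕ} {s z : W n} (hs : s ∈ simpleReflections n)
    (h : length z < length (s * z)) : z ≤ s * z := by
  refine BruhatStep.le ⟨z⁻¹ * s * z, ?_, by group, h⟩
  simpa using (simple_isReflection hs).conj z⁻¹

theorem le_mul_simple {n : ℕ} {s z : W n} (hs : s ∈ simpleReflections n)
    (h : length z < length (z * s)) : z ≤ z * s :=
  BruhatStep.le ⟨s, simple_isReflection hs, rfl, h⟩

theorem simple_mul_simple_mul {n : ℕ} (hn : 1 ≤ n) {s : W n} (hs : s ∈ simpleReflections n)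
    (z : W n) : s * (s * z) = z := by
  rw [← mul_assoc, simple_mul_self hn hs, one_mul]

theorem mul_simple_mul_simple {n : ℕ} (hn : 1 ≤ n) {s : W n} (hs : s ∈ simpleReflections n)
    (z : W n) : z * s * s = z := by
  rw [mul_assoc, simple_mul_self hn hs, mul_one]

/-- The step survives unless the transported hyperplane separates `1` from `s`, and only the wall of
`s` does. -/
theorem BruhatStep.simple_mul {n : ℕ} (hn : 1 ≤ n) {s u v : W n} (hs : s ∈ simpleReflections n)
    (h : BruhatStep u v) : v = s * u ∨ BruhatStep (s * u) (s * v) := by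
  obtain ⟨a, b, hab, k, rfl, hk⟩ := (bruhatStep_iff hn).1 h
  obtain ⟨a', b', hab', k', h1, h2⟩ := sameSide_pullback s hab k
  have h3 : s * refl a b hab k = refl a' b' hab' k' * s := by
    calc s * refl a b hab k = s * (refl a b hab k * s) * s := by
          rw [← mul_assoc, mul_simple_mul_simple hn hs]
      _ = refl a' b' hab' k' * s := by rw [h2, simple_mul_simple_mul hn hs]
  by_cases hss : SameSide a' b' k' 1 s
  · right
    refine (bruhatStep_iff hn).2 ⟨a', b', hab', k', ?_, ?_⟩
    · rw [← mul_assoc, h3, mul_assoc]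
    · refine hss.trans ?_
      rw [← h1, simple_mul_self hn hs, simple_mul_simple_mul hn hs]
      exact hk
  · left
    have := eq_of_not_sameSide hn hs hab' hss
    rw [← this] at h2
    rw [mul_right_cancel h2]

theorem BruhatStep.mul_simple {n : ℕ} (hn : 1 ≤ n) {s u v : W n} (hs : s ∈ simpleReflections n)
    (h : BruhatStep u v) : v = u * s ∨ BruhatStep (u * s) (v * s) := by
  obtain ⟨a, b, hab, k, rfl, hk⟩ := (bruhatStep_iff hn).1 h
  by_cases hss : SameSide a b k u (u * s)
  · exact Or.inr ((bruhatStep_iff hn).2 ⟨a, b, hab, k, mul_assoc _ _ _, hk.trans hss⟩)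
  · exact Or.inl (refl_mul_eq_of_not_sameSide hn hs hab hss)

/-- Lifting property: `s` is pushed up the chain of steps until a step absorbs it or the top is
reached. The three variants below are analogous. -/
theorem simple_mul_le_of_le {n : ℕ} (hn : 1 ≤ n) {s u v : W n} (hs : s ∈ simpleReflections n)
    (h : u ≤ v) (hv : length (s * v) < length v) : s * u ≤ v := by
  have h' : Relation.ReflTransGen BruhatStep u v := h
  induction h' using Relation.ReflTransGen.head_induction_on with
  | refl =>
    have := le_simple_mul (z := s * v) hs (by rwa [simple_mul_simple_mul hn hs])
    rwa [simple_mul_simple_mul hn hs] at this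
  | head h1 h2 ih =>
    rcases h1.simple_mul hn hs with rfl | h3
    · exact h2
    · exact h3.le.trans (ih h2)

theorem mul_simple_le_of_le {n : ℕ} (hn : 1 ≤ n) {s u v : W n} (hs : s ∈ simpleReflections n)
    (h : u ≤ v) (hv : length (v * s) < length v) : u * s ≤ v := by
  have h' : Relation.ReflTransGen BruhatStep u v := h
  induction h' using Relation.ReflTransGen.head_induction_on with
  | refl =>
    have := le_mul_simple (z := v * s) hs (by rwa [mul_simple_mul_simple hn hs])
    rwa [mul_simple_mul_simple hn hs] at this
  | head h1 h2 ih =>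
    rcases h1.mul_simple hn hs with rfl | h3
    · exact h2
    · exact h3.le.trans (ih h2)

theorem le_simple_mul_of_le {n : ℕ} (hn : 1 ≤ n) {s u v : W n} (hs : s ∈ simpleReflections n)
    (h : u ≤ v) (hu : length u < length (s * u)) : u ≤ s * v := by
  have h' : Relation.ReflTransGen BruhatStep u v := h
  induction h' with
  | refl => exact le_simple_mul hs hu
  | tail h1 h2 ih =>
    rcases h2.simple_mul hn hs with rfl | h3
    · rw [simple_mul_simple_mul hn hs]
      exact h1
    · exact (ih h1).trans h3.le

theorem le_mul_simple_of_le {n : ℕ} (hn : 1 ≤ n) {s u v : W n} (hs : s ∈ simpleReflections n)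
    (h : u ≤ v) (hu : length u < length (u * s)) : u ≤ v * s := by
  have h' : Relation.ReflTransGen BruhatStep u v := h
  induction h' with
  | refl => exact le_mul_simple hs hu
  | tail h1 h2 ih =>
    rcases h2.mul_simple hn hs with rfl | h3
    · rw [mul_simple_mul_simple hn hs]
      exact h1
    · exact (ih h1).trans h3.le

theorem length_mul_simple_ne {n : ℕ} (hn : 1 ≤ n) {s : W n} (hs : s ∈ simpleReflections n)
    (z : W n) : length (z * s) ≠ length z := by
  obtain ⟨a, b, h, k, hr⟩ := ((simple_isReflection hs).conj z).exists_refl hn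
  have hr' : z * s = refl a b h k * z := by rw [← hr]; group
  have h1 := length_refl_mul_lt_iff hn h (k := k) (z := z)
  have h2 := lt_length_refl_mul_iff hn h (k := k) (z := z)
  rw [hr']
  by_cases h3 : SameSide a b k 1 z
  · exact (h2.2 h3).ne'
  · exact (h1.2 h3).ne

/-! ### Cancellation of reduced factors -/

/-- If no inversion hyperplane of the word separates `1` from `z` or `z'`, every letter lengthens
both products, and the lifting property adds or removes it on both sides. -/
theorem mul_le_mul_iff_of_word {n : ℕ} (hn : 1 ≤ n) {z z' : W n} (l : List (W n))
    (hl : ∀ s ∈ l, s ∈ simpleReflections n) (hred : length l.prod = l.length)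
    (H : ∀ (a b : Fin (n + 1)) (h : a ≠ b) (k : ℤ),
      length (l.prod * refl a b h k) < length l.prod → SameSide a b k 1 z ∧ SameSide a b k 1 z') :
    l.prod * z ≤ l.prod * z' ↔ z ≤ z' := by
  induction l with
  | nil => simp
  | cons s l ih =>
    obtain ⟨hs, hl⟩ := List.forall_mem_cons.1 hl
    rw [List.prod_cons] at hred H ⊢
    have h1 := length_simple_mul_le hn hs l.prod
    have h2 := length_prod_le hl
    rw [List.length_cons] at hred
    rw [← ih hl (by omega) fun a b h k hlt => H a b h k ?_]
    swap
    · rw [mul_assoc]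
      have := length_simple_mul_le hn hs (l.prod * refl a b h k)
      omega
    -- The wall of `s`, pulled back along the rest of the word, is an inversion of the whole word.
    have key : ∀ x : W n, (∀ (a b : Fin (n + 1)) (h : a ≠ b) (k : ℤ),
        length (s * l.prod * refl a b h k) < length (s * l.prod) → SameSide a b k 1 x) →
        length (l.prod * x) < length (s * (l.prod * x)) := by
      intro x hx
      obtain ⟨a, b, h, k, rfl⟩ := (simple_isReflection hs).exists_refl hn
      obtain ⟨a', b', h', k', h3, h4⟩ := sameSide_pullback l.prod h k
      refine (lt_length_refl_mul_iff hn h).2 (SameSide.trans (v := l.prod) ?_ ?_)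
      · rw [← lt_length_refl_mul_iff hn h]
        omega
      · have := hx a' b' h' k' (by
          rw [h4, mul_assoc, refl_mul_self, mul_one, ← h4]
          omega)
        rwa [← h3, mul_one] at this
    have hz := key z fun a b h k hlt => (H a b h k hlt).1
    have hz' := key z' fun a b h k hlt => (H a b h k hlt).2
    rw [mul_assoc, mul_assoc]
    constructor
    · intro h
      have := le_simple_mul_of_le hn hs ((le_simple_mul hs hz).trans h) hz
      rwa [simple_mul_simple_mul hn hs] at this
    · intro h
      refine simple_mul_le_of_le hn hs (h.trans (le_simple_mul hs hz')) ?_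
      rwa [simple_mul_simple_mul hn hs]

theorem mul_le_mul_iff_of_sameSide {n : ℕ} (hn : 1 ≤ n) {t z z' : W n}
    (H : ∀ (a b : Fin (n + 1)) (h : a ≠ b) (k : ℤ),
      length (t * refl a b h k) < length t → SameSide a b k 1 z ∧ SameSide a b k 1 z') :
    t * z ≤ t * z' ↔ z ≤ z' := by
  obtain ⟨l, hlen, hl, rfl⟩ := exists_reduced_word hn t
  exact mul_le_mul_iff_of_word hn l hl hlen.symm H

/-! ### Dominant elements -/

theorem mem_fundAlcove_iff {n : ℕ} {v : E n} : v ∈ fundAlcove n ↔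
    ∀ a b : Fin (n + 1), a < b → -1 < v.1 a - v.1 b ∧ v.1 a - v.1 b < 0 := by
  constructor
  · intro h a b hab
    have := h _ ⟨a, b, hab, rfl⟩
    rwa [inner_root] at this
  · rintro h _ ⟨a, b, hab, rfl⟩
    rw [inner_root]
    exact h a b hab

theorem basePoint_mem_fundAlcove (n : ℕ) : basePoint n ∈ fundAlcove n :=
  mem_fundAlcove_iff.2 fun a b h => ⟨neg_one_lt_diff_one (n := n) a b, diff_one_neg (n := n) h⟩

/-- No hyperplane cuts the fundamental alcove, so one point of it can stand for all. -/
theorem lt_sub_of_mem_fundAlcove {n : ℕ} {p q : E n} (hp : p ∈ fundAlcove n)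
    (hq : q ∈ fundAlcove n) {a b : Fin (n + 1)} (h : a ≠ b) {k : ℤ}
    (hk : (k : ℝ) < p.1 a - p.1 b) : (k : ℝ) < q.1 a - q.1 b := by
  rcases lt_or_gt_of_ne h with h | h
  · obtain ⟨-, h2⟩ := mem_fundAlcove_iff.1 hp a b h
    obtain ⟨h3, -⟩ := mem_fundAlcove_iff.1 hq a b h
    have : k < 0 := by exact_mod_cast hk.trans h2
    have : (k : ℝ) ≤ -1 := by exact_mod_cast (by omega : k ≤ -1)
    linarith
  · obtain ⟨h1, -⟩ := mem_fundAlcove_iff.1 hp b a h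
    obtain ⟨-, h4⟩ := mem_fundAlcove_iff.1 hq b a h
    have : (k : ℝ) < 1 := by linarith
    have : k < 1 := by exact_mod_cast this
    have : (k : ℝ) ≤ 0 := by exact_mod_cast (by omega : k ≤ 0)
    linarith

theorem mem_dominantElements_iff {n : ℕ} {z : W n} : z ∈ dominantElements n ↔
    ∀ a b : Fin (n + 1), a < b → 0 < diff z a b := by
  constructor
  · intro hz a b h
    have := hz ⟨_, basePoint_mem_fundAlcove n, rfl⟩ _ ⟨a, b, h, rfl⟩
    rwa [inner_root] at this
  · rintro hz _ ⟨p, hp, rfl⟩ _ ⟨a, b, h, rfl⟩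
    rw [inner_root]
    obtain ⟨a', b', h', k', h1, -⟩ := exists_pullback z h.ne 0
    have h2 := h1 p
    have h3 := h1 (basePoint n)
    have h4 := hz a b h
    unfold diff at h4
    have := lt_sub_of_mem_fundAlcove (basePoint_mem_fundAlcove n) hp h' (k := k')
      (by push_cast at h3; linarith)
    push_cast at h2
    linarith

theorem mem_dominantElements_of_simple {n : ℕ} {z : W n}
    (h : ∀ i : Fin n, 0 < diff z i.castSucc i.succ) : z ∈ dominantElements n := by
  refine mem_dominantElements_iff.2 fun a b hab => ?_
  have hanti : StrictAnti fun i => (z.1 (basePoint n)).1 i :=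
    Fin.strictAnti_iff_succ_lt.2 fun i => sub_pos.1 (h i)
  exact sub_pos.2 (hanti hab)

/-- Leaving the chamber means crossing some `H_{α_i,0}`, the only hyperplane between the two
adjacent alcoves. -/
theorem exists_simple_of_mul_not_dominant {n : ℕ} (hn : 1 ≤ n) {v s : W n}
    (hs : s ∈ simpleReflections n) (hv : v ∈ dominantElements n)
    (hvs : v * s ∉ dominantElements n) : ∃ i : Fin n,
      v * s = refl i.castSucc i.succ (Fin.castSucc_lt_succ).ne 0 * v := by
  obtain ⟨i, hi⟩ : ∃ i : Fin n, ¬ 0 < diff (v * s) i.castSucc i.succ := by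
    by_contra! h
    exact hvs (mem_dominantElements_of_simple h)
  refine ⟨i, (refl_mul_eq_of_not_sameSide hn hs _ ?_).symm⟩
  have h1 := mem_dominantElements_iff.1 hv _ _ (Fin.castSucc_lt_succ (i := i))
  have h2 := diff_ne (v * s) (Fin.castSucc_lt_succ (i := i)).ne 0
  push_cast at h2
  have h3 := lt_of_le_of_ne (not_lt.1 hi) h2
  unfold SameSide
  push_cast
  intro h4
  linarith [h4.2 h3]

theorem length_refl_zero_mul_lt {n : ℕ} (hn : 1 ≤ n) {v : W n} {a b : Fin (n + 1)} (h : a < b)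
    (hv : v ∈ dominantElements n) : length (refl a b h.ne 0 * v) < length v := by
  refine length_refl_mul_lt hn h.ne fun h1 => ?_
  have h2 := mem_dominantElements_iff.1 hv _ _ h
  unfold SameSide at h1
  push_cast at h1
  linarith [h1.1 (diff_one_neg h)]

theorem mul_simple_dominant {n : ℕ} (hn : 1 ≤ n) {v s : W n}
    (hs : s ∈ simpleReflections n) (hv : v ∈ dominantElements n)
    (hlt : length v < length (v * s)) : v * s ∈ dominantElements n := by
  by_contra h
  obtain ⟨i, hi⟩ := exists_simple_of_mul_not_dominant hn hs hv h
  have := length_refl_zero_mul_lt hn (Fin.castSucc_lt_succ (i := i)) hv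
  rw [hi] at hlt
  omega

/-- The dominant element whose closed alcove contains the origin. -/
theorem exists_lowest (n : ℕ) : ∃ d : W n, ∀ a b, diff d a b = diff 1 a.rev b.rev := by
  obtain ⟨z, -, hz⟩ := exists_perm_mem_closure (n := n) Fin.revPerm
  refine ⟨z, fun a b => ?_⟩
  unfold diff
  rw [hz, hz]
  rfl

/-- The last letter of a reduced word of `d⁻¹ w` crosses a hyperplane separating `d` from `w`. On a
positive root its level is at least 1, so it is no chamber wall, and it does not separate `1` from
`d`: crossing it keeps dominance and shortens `w`. -/
theorem exists_dominant_descent {n : ℕ} (hn : 1 ≤ n) {d w : W n}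
    (hd : ∀ a b, diff d a b = diff 1 a.rev b.rev) (hw : w ∈ dominantElements n) (hdw : w ≠ d) :
    ∃ s ∈ simpleReflections n, w * s ∈ dominantElements n ∧ length (w * s) < length w := by
  have hd0 : ∀ a b, a < b → 0 < diff d a b := fun a b h => by
    rw [hd, diff_symm]
    exact neg_pos.2 (diff_one_neg (Fin.rev_lt_rev.2 h))
  have hd1 : ∀ a b, diff d a b < 1 := fun a b => by
    rw [hd]
    exact diff_one_lt_one _ _
  obtain ⟨l, hlen, hl, hlp⟩ := exists_reduced_word hn (d⁻¹ * w)
  rcases List.eq_nil_or_concat l with rfl | ⟨l', s, rfl⟩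
  · exfalso
    apply hdw
    rw [List.prod_nil] at hlp
    exact (inv_mul_eq_one.1 hlp.symm).symm
  have hs : s ∈ simpleReflections n := hl s (by simp)
  refine ⟨s, hs, ?_⟩
  have hlt : length (d⁻¹ * w * s) < length (d⁻¹ * w) := by
    rw [← hlen, ← hlp, List.prod_concat, mul_simple_mul_simple hn hs]
    exact (length_prod_le fun t ht => hl t (by simp [ht])).trans_lt (by simp)
  obtain ⟨a, b, h, k, hr⟩ := ((simple_isReflection hs).conj (d⁻¹ * w)).exists_refl hn
  have hr' : refl a b h k * (d⁻¹ * w) = d⁻¹ * w * s := by rw [← hr]; group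
  rw [← hr', length_refl_mul_lt_iff hn h] at hlt
  obtain ⟨a₁, b₁, hab₁, k₁, hS₁, hR₁⟩ : ∃ (a b : Fin (n + 1)) (h : a < b) (k : ℤ),
      ¬ SameSide a b k d w ∧ refl a b h.ne k * w = w * s := by
    obtain ⟨a', b', h', k', h1, h2⟩ := sameSide_pullback d⁻¹ h k
    have h3 : ¬ SameSide a' b' k' d w := by
      rw [← h1, inv_mul_cancel]
      exact hlt
    have h4 : refl a' b' h' k' * w = w * s := by
      rw [← mul_assoc, h2, mul_assoc, mul_assoc d⁻¹] at hr'
      exact mul_left_cancel hr'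
    rcases lt_or_gt_of_ne h' with h5 | h5
    · exact ⟨a', b', h5, k', h3, h4⟩
    · refine ⟨b', a', h5, -k', ?_, ?_⟩
      · rwa [sameSide_symm_index h']
      · rwa [← refl_symm]
  have hw1 := mem_dominantElements_iff.1 hw _ _ hab₁
  have hdpos := hd0 _ _ hab₁
  have hk : 0 < k₁ := by
    by_contra hk
    have : (k₁ : ℝ) ≤ 0 := by exact_mod_cast not_lt.1 hk
    apply hS₁
    unfold SameSide
    constructor <;> intro <;> linarith
  have hk' : (1 : ℝ) ≤ k₁ := by exact_mod_cast hk
  have h1d : SameSide a₁ b₁ k₁ 1 d := by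
    have := hd1 a₁ b₁
    have := diff_one_neg hab₁
    unfold SameSide
    constructor <;> intro <;> linarith
  constructor
  · by_contra hnd
    obtain ⟨i, hi⟩ := exists_simple_of_mul_not_dominant hn hs hw hnd
    rw [← hR₁] at hi
    have h6 := mul_right_cancel hi
    have h7 := length_refl_zero_mul_lt hn (Fin.castSucc_lt_succ (i := i))
      (mem_dominantElements_iff.2 hd0)
    rw [← h6] at h7
    have := (lt_length_refl_mul_iff hn hab₁.ne).2 h1d
    omega
  · rw [← hR₁]
    exact length_refl_mul_lt hn _ fun h => hS₁ (h1d.symm.trans h)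

theorem lowest_le {n : ℕ} (hn : 1 ≤ n) {d w : W n}
    (hd : ∀ a b, diff d a b = diff 1 a.rev b.rev) (hw : w ∈ dominantElements n) : d ≤ w := by
  induction hN : length w using Nat.strong_induction_on generalizing w with
  | _ N ih =>
    subst hN
    by_cases h : w = d
    · exact h.symm.le
    obtain ⟨s, hs, hws, hlt⟩ := exists_dominant_descent hn hd hw h
    refine (ih _ hlt hws rfl).trans ?_
    have := le_mul_simple (z := w * s) hs (by rwa [mul_simple_mul_simple hn hs])
    rwa [mul_simple_mul_simple hn hs] at this

/-- A dominant element strictly below a dominant `w` lies below a dominant element covered by `w`. -/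
theorem exists_dominant_coatom {n : ℕ} (hn : 1 ≤ n) {u w : W n} (hu : u ∈ dominantElements n)
    (hw : w ∈ dominantElements n) (huw : u ≤ w) (hne : u ≠ w) :
    ∃ v ∈ dominantElements n, u ≤ v ∧ v ≤ w ∧ length w = length v + 1 := by
  induction hN : length w using Nat.strong_induction_on generalizing u w with
  | _ N ih =>
    subst hN
    obtain ⟨d, hd⟩ := exists_lowest n
    have hwd : w ≠ d := by
      rintro rfl
      exact hne (le_antisymm huw (lowest_le hn hd hu))
    obtain ⟨s, hs, hws, hlt⟩ := exists_dominant_descent hn hd hw hwd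
    have hss := mul_simple_mul_simple hn hs
    have hwsw : w * s ≤ w := by
      have := le_mul_simple (z := w * s) hs (by rwa [hss])
      rwa [hss] at this
    have hlen : length w = length (w * s) + 1 := by
      have := length_mul_simple_le hn hs (w * s)
      rw [hss] at this
      omega
    by_cases hus : length u < length (u * s)
    · exact ⟨w * s, hws, le_mul_simple_of_le hn hs huw hus, hwsw, hlen⟩
    have hus' : length (u * s) < length u :=
      lt_of_le_of_ne (not_lt.1 hus) (length_mul_simple_ne hn hs u)
    have husu : u * s ≤ u := by
      have := le_mul_simple (z := u * s) hs (by rwa [hss])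
      rwa [hss] at this
    have husws : u * s ≤ w * s :=
      le_mul_simple_of_le hn hs (husu.trans huw) (by rwa [hss])
    -- Both `u` and `w` now descend under `s`: recurse on the pair `u s`, `w s` and lift the
    -- resulting coatom back by `s`.
    by_cases hdom : u * s ∈ dominantElements n
    · obtain ⟨v, hv, h1, h2, h3⟩ := ih _ hlt hdom hws husws
        (fun h => hne (mul_right_cancel h)) rfl
      by_cases hvs : length v < length (v * s)
      · refine ⟨v * s, mul_simple_dominant hn hs hv hvs, ?_, ?_, ?_⟩
        · have := mul_simple_le_of_le hn hs (h1.trans (le_mul_simple hs hvs)) (by rwa [hss])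
          rwa [hss] at this
        · exact mul_simple_le_of_le hn hs (h2.trans hwsw) hlt
        · have := length_mul_simple_le hn hs v
          omega
      · have := mul_simple_le_of_le hn hs h1
          (lt_of_le_of_ne (not_lt.1 hvs) (length_mul_simple_ne hn hs v))
        rw [hss] at this
        exact ⟨w * s, hws, this.trans h2, hwsw, hlen⟩
    -- Here `u s = s_i u`, and `s_i` on the left shortens the dominant `w s`, so lifting gives `u ≤
    -- w s`.
    · obtain ⟨i, hi⟩ := exists_simple_of_mul_not_dominant hn hs hu hdom
      rw [hi] at husws
      have := simple_mul_le_of_le hn (refl_mem_simpleReflections i) husws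
        (length_refl_zero_mul_lt hn (Fin.castSucc_lt_succ (i := i)) hws)
      rw [← mul_assoc, refl_mul_self, one_mul] at this
      exact ⟨w * s, hws, this, hwsw, hlen⟩

/-- A covering relation between dominant elements is a reflection in a nearest hyperplane. -/
theorem exists_refl_of_dominant_cover {n : ℕ} (hn : 1 ≤ n) {u w : W n}
    (hu : u ∈ dominantElements n) (hw : w ∈ dominantElements n) (huw : u ≤ w)
    (hlen : length w = length u + 1) : ∃ (a b : Fin (n + 1)) (h : a < b) (k : ℤ),
      u = refl a b h.ne k * w ∧ (k : ℝ) < diff w a b ∧ diff w a b < k + 1 := by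
  obtain ⟨a, b, hab, k, hwu, hside⟩ : ∃ (a b : Fin (n + 1)) (h : a < b) (k : ℤ),
      w = refl a b h.ne k * u ∧ SameSide a b k 1 u := by
    obtain ⟨a, b, h, k, h1, h2⟩ := (bruhatStep_iff hn).1 (bruhatStep_of_length_eq huw hlen)
    rcases lt_or_gt_of_ne h with h' | h'
    · exact ⟨a, b, h', k, h1, h2⟩
    · refine ⟨b, a, h', -k, ?_, ?_⟩
      · rw [← refl_symm]
        exact h1
      · rwa [sameSide_symm_index h]
  have hu0 := mem_dominantElements_iff.1 hu _ _ hab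
  have hw0 := mem_dominantElements_iff.1 hw _ _ hab
  have h10 := diff_one_neg hab
  have hdw : diff w a b = 2 * k - diff u a b := by rw [hwu, diff_refl_mul]
  have hk : 0 < (k : ℝ) := by linarith
  have huk : diff u a b < k := hside.1 (h10.trans hk)
  refine ⟨a, b, hab, k, ?_, by linarith, ?_⟩
  · rw [hwu, ← mul_assoc, refl_mul_self, one_mul]
  by_contra hcon
  have hcon : (k : ℝ) + 1 < diff w a b := by
    refine lt_of_le_of_ne (not_lt.1 hcon) fun h => diff_ne w hab.ne (k + 1) ?_
    rw [← h]
    push_cast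
    rfl
  set j := ⌊diff w a b⌋ with hj
  have hj1 : (j : ℝ) < diff w a b :=
    lt_of_le_of_ne (Int.floor_le _) (diff_ne w hab.ne j).symm
  have hj2 : diff w a b < j + 1 := Int.lt_floor_add_one _
  have hkj : k + 1 ≤ j := by
    rw [hj, Int.le_floor]
    push_cast
    exact hcon.le
  have hkj' : (k : ℝ) + 1 ≤ j := by exact_mod_cast hkj
  have hi : 1 ≤ 2 * k - j := by
    have : (j : ℝ) < 2 * k := by linarith
    have : j < 2 * k := by exact_mod_cast this
    omega
  have hi' : (1 : ℝ) ≤ 2 * k - j := by exact_mod_cast hi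
  -- If a level `j > k` lies below `w`, then mirroring in `2k - j`, `k`, `j` goes from `u` to `w` in
  -- three length-increasing steps, so `w` is not a cover. Dominance of `u` makes `2k - j` positive.
  have hwe : w = refl a b hab.ne j * (refl a b hab.ne k * (refl a b hab.ne (2 * k - j) * u)) := by
    rw [hwu, ← mul_assoc (refl a b hab.ne k), ← mul_assoc, refl_mul_refl_mul]
    congr 2
    ring
  have step : ∀ (l : ℤ) (x : W n) (_ : 0 < (l : ℝ)) (_ : diff x a b < l),
      length x < length (refl a b hab.ne l * x) := fun l x hl hx =>
    (lt_length_refl_mul_iff hn hab.ne).2 ⟨fun _ => hx, fun _ => h10.trans hl⟩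
  have s1 := step (2 * k - j) u (by push_cast; linarith) (by push_cast; linarith)
  have e1 := diff_refl_mul u hab.ne (2 * k - j)
  push_cast at e1
  have s2 := step k (refl a b hab.ne (2 * k - j) * u) hk (by linarith)
  have e2 := diff_refl_mul (refl a b hab.ne (2 * k - j) * u) hab.ne k
  have s3 := step j (refl a b hab.ne k * (refl a b hab.ne (2 * k - j) * u))
    (by linarith) (by linarith)
  rw [← hwe] at s3
  omega

/-! ### Walls of the dominant chamber -/

theorem isometry_W {n : ℕ} (z : W n) : Isometry z.1 := by
  obtain ⟨σ, c, hc⟩ := exists_perm_shift z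
  refine Isometry.of_dist_eq fun u v => ?_
  rw [dist_eq_norm, dist_eq_norm, @norm_eq_sqrt_real_inner (E n), @norm_eq_sqrt_real_inner (E n),
    inner_eq_sum, inner_eq_sum]
  congr 1
  rw [← Equiv.sum_comp σ fun i => (u - v).1 i * (u - v).1 i]
  refine Finset.sum_congr rfl fun i _ => ?_
  have : (z.1 u - z.1 v).1 i = (u - v).1 (σ i) := by
    change (z.1 u).1 i - (z.1 v).1 i = u.1 (σ i) - v.1 (σ i)
    rw [hc, hc]
    ring
  rw [this]

/-- The segment from `v` towards the barycentre lies in the open alcove, except perhaps at `v`. -/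
theorem mem_closure_fundAlcove {n : ℕ} {v : E n}
    (hv : ∀ a b : Fin (n + 1), a < b → -1 ≤ v.1 a - v.1 b ∧ v.1 a - v.1 b ≤ 0) :
    v ∈ closure (fundAlcove n) := by
  have ht : Filter.Tendsto (fun t : ℝ => v + t • (basePoint n - v)) (nhdsWithin 0 (Set.Ioi 0))
      (nhds v) := by
    have : Continuous fun t : ℝ => v + t • (basePoint n - v) := by fun_prop
    have h := (this.tendsto 0).mono_left (nhdsWithin_le_nhds (s := Set.Ioi (0 : ℝ)))
    simpa using h
  refine mem_closure_of_tendsto ht ?_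
  filter_upwards [Ioo_mem_nhdsGT (zero_lt_one (α := ℝ))] with t ht
  obtain ⟨ht0, ht1⟩ := ht
  refine mem_fundAlcove_iff.2 fun a b h => ?_
  have e : ∀ i, (v + t • (basePoint n - v)).1 i = v.1 i + t * ((basePoint n).1 i - v.1 i) :=
    fun i => rfl
  rw [e, e]
  obtain ⟨h1, h2⟩ := hv a b h
  obtain ⟨h3, h4⟩ := mem_fundAlcove_iff.1 (basePoint_mem_fundAlcove n) a b h
  constructor <;> nlinarith

/-- The wall pulls back to a hyperplane of level -1 (if `a < b`) or 0 (if `b < a`), which contains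
the vertex `-ϖ` attached to `a`, respectively the origin. -/
theorem closure_alcove_inter_wall_nonempty {n : ℕ} {z : W n} (hz : z ∈ dominantElements n)
    (i : Fin n) (hi : diff z i.castSucc i.succ < 1) :
    (closure (alcove z) ∩ hyperplane (simpleRoot i) 0).Nonempty := by
  have hne := (Fin.castSucc_lt_succ (i := i)).ne
  have h0 := mem_dominantElements_iff.1 hz _ _ (Fin.castSucc_lt_succ (i := i))
  obtain ⟨a, b, h, k, h1, -⟩ := exists_pullback z hne 0
  have hb := h1 (basePoint n)
  have hdz : diff z i.castSucc i.succ = diff 1 a b - k := by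
    have : diff z i.castSucc i.succ - ((0 : ℤ) : ℝ) = diff 1 a b - k := hb
    simpa using this
  have main : ∀ v : E n, v ∈ closure (fundAlcove n) → v.1 a - v.1 b = k →
      (closure (alcove z) ∩ hyperplane (simpleRoot i) 0).Nonempty := by
    intro v hv hvk
    refine ⟨z.1 v, image_closure_subset_closure_image (isometry_W z).continuous ⟨v, hv, rfl⟩, ?_⟩
    have := h1 v
    change inner ℝ (simpleRoot i) (z.1 v) = ((0 : ℤ) : ℝ)
    unfold simpleRoot
    rw [inner_root]
    linarith
  rcases lt_or_gt_of_ne h with hab | hab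
  · have d1 := diff_one_neg hab
    have d2 := neg_one_lt_diff_one a b
    obtain rfl : k = -1 := by
      have k1 : (k : ℝ) < 0 := by linarith
      have k2 : (-2 : ℝ) < k := by linarith
      have k1 : k < 0 := by exact_mod_cast k1
      have k2 : -2 < k := by exact_mod_cast k2
      omega
    obtain ⟨j, rfl⟩ : ∃ j : Fin n, j.castSucc = a :=
      ⟨a.castPred (hab.trans_le (Fin.le_last b)).ne, by simp⟩
    have e : ∀ c d, (-fundWeight j : E n).1 c - (-fundWeight j : E n).1 d =
        (if d ≤ j.castSucc then 1 else 0) - (if c ≤ j.castSucc then 1 else 0) := by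
      intro c d
      change -((if c ≤ j.castSucc then 1 else 0) - ((j : ℝ) + 1) / ((n : ℝ) + 1)) -
        -((if d ≤ j.castSucc then 1 else 0) - ((j : ℝ) + 1) / ((n : ℝ) + 1)) = _
      ring
    refine main (-fundWeight j) (mem_closure_fundAlcove fun c d hcd => ?_) ?_
    · rw [e]
      by_cases hd : d ≤ j.castSucc
      · simp [hd, hcd.le.trans hd]
      · by_cases hc : c ≤ j.castSucc <;> simp [hd, hc]
    · rw [e]
      simp [hab]
  · have d1 := diff_one_neg hab
    have d2 := neg_one_lt_diff_one b a
    rw [diff_symm] at d1 d2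
    obtain rfl : k = 0 := by
      have k1 : (k : ℝ) < 1 := by linarith
      have k2 : (-1 : ℝ) < k := by linarith
      have k1 : k < 1 := by exact_mod_cast k1
      have k2 : -1 < k := by exact_mod_cast k2
      omega
    have e : ∀ c, (0 : E n).1 c = 0 := fun c => rfl
    refine main 0 (mem_closure_fundAlcove fun c d hcd => ?_) ?_
    · rw [e, e]
      norm_num
    · rw [e, e]
      norm_num

/-! ### Translations -/

theorem translate_eq_mul {n : ℕ} (m : rootLattice n) (z : W n) :
    translate m z = translate m 1 * z := rfl

theorem diff_translate {n : ℕ} (m : rootLattice n) (z : W n) (a b : Fin (n + 1)) :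
    diff (translate m z) a b = diff z a b + (m.1.1 a - m.1.1 b) := by
  have e : ∀ i, ((translate m z).1 (basePoint n)).1 i = m.1.1 i + (z.1 (basePoint n)).1 i :=
    fun i => rfl
  unfold diff
  rw [e, e]
  ring

theorem translate_le_translate_iff {n : ℕ} (hn : 1 ≤ n) {m : rootLattice n}
    (hm : ∀ a b : Fin (n + 1), a < b → 0 ≤ m.1.1 a - m.1.1 b) {z z' : W n}
    (hz : z ∈ dominantElements n) (hz' : z' ∈ dominantElements n) :
    translate m z ≤ translate m z' ↔ z ≤ z' := by
  rw [translate_eq_mul m z, translate_eq_mul m z']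
  set T := translate m 1
  have hT : ∀ a b, diff T⁻¹ a b = diff 1 a b - (m.1.1 a - m.1.1 b) := fun a b => by
    have := diff_translate m T⁻¹ a b
    rw [translate_eq_mul, mul_inv_cancel] at this
    linarith
  have key : ∀ (a b : Fin (n + 1)), a < b → ∀ (k : ℤ) (x : W n), x ∈ dominantElements n →
      ¬ SameSide a b k T⁻¹ 1 → SameSide a b k 1 x := by
    intro a b hab k x hx hS
    have h1 := hm a b hab
    have h2 := hT a b
    have h3 := mem_dominantElements_iff.1 hx a b hab
    have h4 := neg_one_lt_diff_one a b
    have h5 := diff_one_neg hab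
    -- A separating level lies below `1`, hence below every dominant `x` too.
    have hk : (k : ℝ) ≤ diff 1 a b := by
      by_contra hk
      apply hS
      unfold SameSide
      constructor <;> intro <;> linarith
    unfold SameSide
    constructor <;> intro <;> linarith
  have side : ∀ (a b : Fin (n + 1)) (h : a ≠ b) (k : ℤ) (x : W n), x ∈ dominantElements n →
      ¬ SameSide a b k T⁻¹ 1 → SameSide a b k 1 x := by
    intro a b h k x hx hS
    rcases lt_or_gt_of_ne h with h' | h'
    · exact key a b h' k x hx hS
    · rw [← sameSide_symm_index h] at hS ⊢
      exact key b a h' _ x hx hS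
  refine mul_le_mul_iff_of_sameSide hn fun a b h k hlt => ?_
  -- Right inversions of `T` are the hyperplanes separating `T⁻¹` from `1`.
  have hS : ¬ SameSide a b k T⁻¹ 1 := by
    obtain ⟨a', b', h', k', h1, h2⟩ := sameSide_pullback T⁻¹ h k
    have h3 : T * refl a b h k = refl a' b' h' k' * T := by
      rw [← mul_inv_eq_iff_eq_mul, mul_assoc, h2, mul_inv_cancel_left]
    rw [h3, length_refl_mul_lt_iff hn] at hlt
    rwa [← h1, mul_one, inv_mul_cancel] at hlt
  exact ⟨side a b h k z hz hS, side a b h k z' hz' hS⟩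

theorem translate_mem_dominantElements {n : ℕ} {m : rootLattice n}
    (hm : ∀ a b : Fin (n + 1), a < b → 0 ≤ m.1.1 a - m.1.1 b) {z : W n}
    (hz : z ∈ dominantElements n) : translate m z ∈ dominantElements n := by
  refine mem_dominantElements_iff.2 fun a b h => ?_
  rw [diff_translate]
  linarith [hm a b h, mem_dominantElements_iff.1 hz a b h]

/-- The point moves by less than one copy of the root, and a positive root other than `α_i` pairs
with `α_i` to at most 1. -/
theorem diff_refl_mul_gt {n : ℕ} {a b : Fin (n + 1)} (hab : a < b) {k : ℤ} {w : W n}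
    (h1 : (k : ℝ) < diff w a b) (h2 : diff w a b < k + 1) (i : Fin n)
    (hi : ¬ (a = i.castSucc ∧ b = i.succ)) :
    diff w i.castSucc i.succ - 1 < diff (refl a b hab.ne k * w) i.castSucc i.succ := by
  have hsucc := Fin.castSucc_lt_succ (i := i)
  unfold diff at *
  rw [mul_apply_coord]
  generalize w.1 (basePoint n) = p at *
  by_cases ha : i.castSucc = a
  · have hb : i.succ ≠ b := fun hb => hi ⟨ha.symm, hb.symm⟩
    have hsa : i.succ ≠ a := by rw [← ha]; exact hsucc.ne'
    rw [refl_coord_of_ne _ _ _ hsa hb, ha, refl_coord_left]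
    linarith
  by_cases hb : i.castSucc = b
  · have hsb : i.succ ≠ b := by rw [← hb]; exact hsucc.ne'
    have hsa : i.succ ≠ a := by
      rintro rfl
      rw [← hb] at hab
      exact lt_asymm hab hsucc
    rw [refl_coord_of_ne _ _ _ hsa hsb, hb, refl_coord_right]
    linarith
  rw [refl_coord_of_ne _ _ _ ha hb]
  by_cases hsa : i.succ = a
  · rw [hsa, refl_coord_left]
    linarith
  by_cases hsb : i.succ = b
  · rw [hsb, refl_coord_right]
    linarith
  rw [refl_coord_of_ne _ _ _ hsa hsb]
  linarith

/-- A dominant element covered by the translate of `y` is the translate of a dominant element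
if the translation moves away only from walls that the alcove of `y` does not
touch. -/
theorem dominant_of_translate_cover {n : ℕ} (hn : 1 ≤ n) {m : rootLattice n} {c : Fin n → ℕ}
    (hm : ∀ i : Fin n, m.1.1 i.castSucc - m.1.1 i.succ = c i) {y z : W n}
    (hc : ∀ i, c i ≠ 0 → 1 ≤ diff y i.castSucc i.succ)
    (hyd : translate m y ∈ dominantElements n) (hzd : translate m z ∈ dominantElements n)
    (hzy : translate m z ≤ translate m y)
    (hlen : length (translate m y) = length (translate m z) + 1) : z ∈ dominantElements n := by
  obtain ⟨a, b, hab, k, he, h1, h2⟩ := exists_refl_of_dominant_cover hn hzd hyd hzy hlen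
  refine mem_dominantElements_of_simple fun i => ?_
  have h3 := diff_translate m z i.castSucc i.succ
  have h4 := diff_translate m y i.castSucc i.succ
  rw [hm] at h3 h4
  by_cases hci : c i = 0
  · have := mem_dominantElements_iff.1 hzd _ _ (Fin.castSucc_lt_succ (i := i))
    rw [hci] at h3
    push_cast at h3
    linarith
  have h5 := hc i hci
  by_cases hi : a = i.castSucc ∧ b = i.succ
  · obtain ⟨rfl, rfl⟩ := hi
    have h6 := diff_refl_mul (translate m y) hab.ne k
    rw [← he] at h6
    -- The pairing at `translate m y` is at least `c i + 1`, so the nearest level `k` exceeds `c i`;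
    -- the mirror image has pairing above `k - 1 ≥ c i`.
    have h7 : (c i : ℝ) < k := by linarith
    have h8 : (c i : ℤ) < k := by exact_mod_cast h7
    have h9 : (c i : ℝ) + 1 ≤ k := by exact_mod_cast h8
    linarith
  · have h6 := diff_refl_mul_gt hab h1 h2 i hi
    rw [← he] at h6
    linarith

/-- Descent from `translate m y` to `w` through dominant coatoms. Replacing `y` by a lower `z`
shrinks the interval, so the condition `hc` is inherited. -/
theorem exists_translate_eq {n : ℕ} (hn : 1 ≤ n) {m : rootLattice n} {c : Fin n → ℕ}
    (hm : ∀ i : Fin n, m.1.1 i.castSucc - m.1.1 i.succ = c i)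
    (hm' : ∀ a b : Fin (n + 1), a < b → 0 ≤ m.1.1 a - m.1.1 b) {x y w : W n}
    (hx : x ∈ dominantElements n) (hy : y ∈ dominantElements n)
    (hc : ∀ y', y' ∈ Set.Icc x y ∩ dominantElements n →
      ∀ i, c i ≠ 0 → 1 ≤ diff y' i.castSucc i.succ)
    (hxy : x ≤ y) (hw : w ∈ dominantElements n) (hxw : translate m x ≤ w)
    (hwy : w ≤ translate m y) :
    ∃ z ∈ Set.Icc x y ∩ dominantElements n, translate m z = w := by
  induction hN : length (translate m y) using Nat.strong_induction_on generalizing y with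
  | _ N ih =>
    subst hN
    by_cases hwy' : w = translate m y
    · exact ⟨y, ⟨⟨hxy, le_rfl⟩, hy⟩, hwy'.symm⟩
    have hyd := translate_mem_dominantElements hm' hy
    obtain ⟨v, hv, hwv, hvy, hlen⟩ := exists_dominant_coatom hn hw hyd hwy hwy'
    obtain ⟨z, rfl⟩ : ∃ z, v = translate m z :=
      ⟨(translate m 1)⁻¹ * v, by rw [translate_eq_mul, mul_inv_cancel_left]⟩
    have hz := dominant_of_translate_cover hn hm (hc y ⟨⟨hxy, le_rfl⟩, hy⟩) hyd hv hvy hlen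
    have hxz := (translate_le_translate_iff hn hm' hx hz).1 (hxw.trans hwv)
    have hzy := (translate_le_translate_iff hn hm' hz hy).1 hvy
    obtain ⟨z', ⟨⟨h1, h2⟩, h3⟩, h4⟩ := ih _ (by omega) hz
      (fun y' hy' => hc y' ⟨⟨hy'.1.1, hy'.1.2.trans hzy⟩, hy'.2⟩) hxz hwv rfl
    exact ⟨z', ⟨⟨h1, h2.trans hzy⟩, h3⟩, h4⟩

end AffineTypeA

theorem propositionD (n : ℕ) (hn : 1 ≤ n) (x y : AffineTypeA.W n)
    (hx : x ∈ AffineTypeA.dominantElements n) (hy : y ∈ AffineTypeA.dominantElements n)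
    (hxy : x ≤ y) (m : AffineTypeA.rootLattice n) (c : Fin n → ℕ)
    (hc : ∀ i ∈ AffineTypeA.touchedWalls x y, c i = 0)
    (hm : (m : AffineTypeA.E n) = ∑ i, c i • AffineTypeA.fundWeight i) :
    ∃ f : ↥(Set.Icc x y ∩ AffineTypeA.dominantElements n) ≃o
        ↥(Set.Icc (AffineTypeA.translate m x) (AffineTypeA.translate m y) ∩
          AffineTypeA.dominantElements n),
      ∀ z, (f z : AffineTypeA.W n) = AffineTypeA.translate m (z : AffineTypeA.W n) := by
  open AffineTypeA in
  -- By duality, the coefficients of `m` are its pairings with the simple roots.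
  have hmi : ∀ i : Fin n, m.1.1 i.castSucc - m.1.1 i.succ = c i := fun i => by
    rw [← inner_root, ← simpleRoot, hm, inner_sum, Finset.sum_eq_single i]
    · rw [← Nat.cast_smul_eq_nsmul ℝ, real_inner_smul_right, real_inner_comm,
        inner_fundWeight_simpleRoot]
      simp
    · intro j _ hj
      rw [← Nat.cast_smul_eq_nsmul ℝ, real_inner_smul_right, real_inner_comm,
        inner_fundWeight_simpleRoot]
      simp [hj]
    · simp
  have hanti : Antitone fun i => m.1.1 i := Fin.antitone_iff_succ_le.2 fun i => by
    have := hmi i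
    have h0 : (0 : ℝ) ≤ c i := by positivity
    linarith
  have hm' : ∀ a b : Fin (n + 1), a < b → 0 ≤ m.1.1 a - m.1.1 b := fun a b h =>
    sub_nonneg.2 (hanti h.le)
  have htouch : ∀ y', y' ∈ Set.Icc x y ∩ dominantElements n →
      ∀ i, c i ≠ 0 → 1 ≤ diff y' i.castSucc i.succ := by
    intro y' hy' i hi
    by_contra h
    exact hi (hc i ⟨y', hy', closure_alcove_inter_wall_nonempty hy'.2 i (not_le.1 h)⟩)
  let g : ↥(Set.Icc x y ∩ dominantElements n) →
      ↥(Set.Icc (translate m x) (translate m y) ∩ dominantElements n) := fun z =>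
    ⟨translate m z, ⟨(translate_le_translate_iff hn hm' hx z.2.2).2 z.2.1.1,
      (translate_le_translate_iff hn hm' z.2.2 hy).2 z.2.1.2⟩,
      translate_mem_dominantElements hm' z.2.2⟩
  have hg : ∀ z z', g z ≤ g z' ↔ z ≤ z' := fun z z' =>
    translate_le_translate_iff hn hm' z.2.2 z'.2.2
  have hsurj : Function.Surjective g := fun w => by
    obtain ⟨z, hz, hzw⟩ := exists_translate_eq hn hmi hm' hx hy htouch hxy w.2.2 w.2.1.1 w.2.1.2
    exact ⟨⟨z, hz⟩, Subtype.ext hzw⟩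
  exact ⟨RelIso.ofSurjective (OrderEmbedding.ofMapLEIff g hg) hsurj, fun _ => rfl⟩
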